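/- Let $d\ge 1$ be an integer and $q\in\mathbb C\setminus\{0\}$. **Setting.** For $n\ge 0$ the framed braid group $\mathcal F_n$ is generated by the braid generators $\sigma_1,\dots,\sigma_{n-1}$ and the framing generators $t_1,\dots,t_n$, subject to the braid relations ($\sigma_i\sigma_{i+1}\sigma_i=\sigma_{i+1}\sigma_i\sigma_{i+1}$, and $\sigma_i\sigma_j=\sigma_j\sigma_i$ for $|i-j|>1$), $t_it_j=t_jt_i$, and $t_j\sigma_i=\sigma_i t_{s_i(j)}$ with $s_i=(i\ i{+}1)$. It contains the classical braid group $B_n$. The group $\mathcal F_{d,n}$ is the quotient of $\mathcal F_n$ by $t_j^d=1$ for all $j$. The Yokonuma–Hecke algebra $\mathrm Y_{d,n}(q)$ is the quotient of $\mathbb C\mathcal F_{d,n}$ by the relations $\sigma_i^2=1+(q-q^{-1})e_i\sigma_i$, where $e_i=\frac1d\sum_{s=1}^{d}t_i^st_{i+1}^{-s}$; write $g_i$ for the image of $\sigma_i$. A framed braid $\alpha\in\mathcal F_n$ is regarded as an element of $\mathrm Y_{d,n}(q)$ through the natural maps. Let $\mathrm{tr}_d:\bigcup_n \mathrm Y_{d,n}(q)\to\mathbb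 C[z,x_1,\dots,x_{d-1}]$ be Juyumaya's trace, the unique linear map (that is, the unique family of linear maps on the $\mathrm Y_{d,n}(q)$ compatible with adding a strand on the right) with $$\mathrm{tr}_d(ab)=\mathrm{tr}_d(ba),\quad \mathrm{tr}_d(1)=1,\quad \mathrm{tr}_d(a g_n)=z\,\mathrm{tr}_d(a),\quad \mathrm{tr}_d(a\,t_{n+1}^s)=x_s\,\mathrm{tr}_d(a)\ \ (1\le s\le d-1),$$ for $a,b\in \mathrm Y_{d,n}(q)$. The E-system is the system of equations $E^{(m)}=\mathrm x_mE^{(0)}$ ($1\le m\le d-1$), where $E^{(m)}=\frac1d\sum_{s\in\mathbb Z/d\mathbb Z}\mathrm x_{m+s}\mathrm x_{-s}$, the indices are taken modulo $d$, and $\mathrm x_0=1$. For a non-empty subset $D\subseteq\mathbb Z/d\mathbb Z$, $\mathrm{tr}_{d,D}:\bigcup_n\mathrm Y_{d,n}(q)\to\mathbb C[z]$ is $\mathrm{tr}_d$ with $x_1,\dots,x_{d-1}$ specialized to the solution of the E-system given by $D$, $\mathrm x_k=\frac1{|D|}\sum_{m\in D}\exp(2\pi i\,mk/d)$. **Proposition.**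 Let $m\ge1$, let $0=i_0<i_1<\dots<i_m\le n$ be integers and let $\alpha=\alpha_1\alpha_2\cdots\alpha_m\in\mathcal F_n$ (for example $\alpha\in B_n$), where $\alpha_j$ involves only the strands $i_{j-1}+1,\dots,i_j$: it belongs to the subgroup of $\mathcal F_n$ generated by the $\sigma_k$ with $i_{j-1}<k<i_j$ and the $t_k$ with $i_{j-1}<k\le i_j$. (So the closure of $\alpha$ is the split link $L_1\sqcup\dots\sqcup L_m$, together with unlinked unknots if $i_m<n$, where $L_j$ is the closure of the part of $\alpha_j$ on these strands.) Then, in $\mathbb C[z,x_1,\dots,x_{d-1}]$, $$\mathrm{tr}_d(\alpha)=\mathrm{tr}_d(\alpha_1)\,\mathrm{tr}_d(\alpha_2)\cdots\mathrm{tr}_d(\alpha_m).$$ The same identity holds in $\mathbb C[z]$ for $\mathrm{tr}_d$ with $x_1,\dots,x_{d-1}$ specialized to any solution of the E-system; in particular, for every non-empty $D\subseteq\mathbb Z/d\mathbb Z$, $$\mathrm{tr}_{d,D}(\alpha)=\mathrm{tr}_{d,D}(\alpha_1)\,\mathrm{tr}_{d,D}(\alpha_2)\cdots\mathrm{tr}_{d,D}(\alpha_m).$$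 -/

import Mathlib

noncomputable section

namespace YokonumaHecke

/-! ### Framed braid groups

Strands are numbered `0, …, n - 1`; the generator `σ_i` (`i + 1 < n`) crosses the strands
`i` and `i + 1`, and `t_j` is framing `1` on the strand `j`. -/

/-- The generators of the framed braid group on `n` strands. -/
inductive Gen (n : ℕ) : Type
  | sigma (i : ℕ) (hi : i + 1 < n) : Gen n
  | framing (j : Fin n) : Gen n

/-- The transposition `s_i = (i, i+1)` of the strands. -/
def strandSwap {n : ℕ} (i : ℕ) (hi : i + 1 < n) : Equiv.Perm (Fin n) :=
  Equiv.swap ⟨i, Nat.lt_of_succ_lt hi⟩ ⟨i + 1, hi⟩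

/-- The word `σ_i` in the free group on the generators. -/
def wordSigma {n : ℕ} (i : ℕ) (hi : i + 1 < n) : FreeGroup (Gen n) :=
  FreeGroup.of (Gen.sigma i hi)

/-- The word `t_j` in the free group on the generators. -/
def wordFraming {n : ℕ} (j : Fin n) : FreeGroup (Gen n) :=
  FreeGroup.of (Gen.framing j)

/-- The defining relators of the framed braid group: `u * v⁻¹` for every relation `u = v`. -/
inductive FramedRel (n : ℕ) : FreeGroup (Gen n) → Prop
  /-- `σ_i σ_{i+1} σ_i = σ_{i+1} σ_i σ_{i+1}` -/
  | braid (i : ℕ) (hi : i + 1 < n) (hj : i + 1 + 1 < n) :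
      FramedRel n ((wordSigma i hi * wordSigma (i + 1) hj * wordSigma i hi) *
        (wordSigma (i + 1) hj * wordSigma i hi * wordSigma (i + 1) hj)⁻¹)
  /-- `σ_i σ_j = σ_j σ_i` for `|i - j| > 1` -/
  | comm (i j : ℕ) (hi : i + 1 < n) (hj : j + 1 < n) (hij : i + 1 < j) :
      FramedRel n ((wordSigma i hi * wordSigma j hj) * (wordSigma j hj * wordSigma i hi)⁻¹)
  /-- `t_i t_j = t_j t_i` -/
  | framing_comm (i j : Fin n) :
      FramedRel n ((wordFraming i * wordFraming j) * (wordFraming j * wordFraming i)⁻¹)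
  /-- `t_j σ_i = σ_i t_{s_i(j)}` -/
  | framing_sigma (i : ℕ) (hi : i + 1 < n) (j : Fin n) :
      FramedRel n ((wordFraming j * wordSigma i hi) *
        (wordSigma i hi * wordFraming (strandSwap i hi j))⁻¹)

/-- The defining relators of the modular framed braid group: those of the framed braid group
together with `t_j ^ d`. -/
inductive ModularRel (d n : ℕ) : FreeGroup (Gen n) → Prop
  | framed (w : FreeGroup (Gen n)) (hw : FramedRel n w) : ModularRel d n w
  | modular (j : Fin n) : ModularRel d n (wordFraming j ^ d)

/-- The framed braid group `F_n`. -/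
abbrev FramedBraidGroup (n : ℕ) : Type := PresentedGroup {w | FramedRel n w}

/-- The modular framed braid group `F_{d,n}`. -/
abbrev ModularFramedBraidGroup (d n : ℕ) : Type := PresentedGroup {w | ModularRel d n w}

/-- `σ_i` in `F_n`. -/
def sigma {n : ℕ} (i : ℕ) (hi : i + 1 < n) : FramedBraidGroup n :=
  PresentedGroup.of (Gen.sigma i hi)

/-- `t_j` in `F_n`. -/
def framing {n : ℕ} (j : Fin n) : FramedBraidGroup n :=
  PresentedGroup.of (Gen.framing j)

/-- `σ_i` in `F_{d,n}`. -/
def msigma (d : ℕ) {n : ℕ} (i : ℕ) (hi : i + 1 < n) : ModularFramedBraidGroup d n :=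
  PresentedGroup.of (Gen.sigma i hi)

/-- `t_j` in `F_{d,n}`. -/
def mframing (d : ℕ) {n : ℕ} (j : Fin n) : ModularFramedBraidGroup d n :=
  PresentedGroup.of (Gen.framing j)

/-- The natural epimorphism `F_n → F_{d,n}`. -/
def reduceFraming (d n : ℕ) : FramedBraidGroup n →* ModularFramedBraidGroup d n :=
  PresentedGroup.toGroup (f := PresentedGroup.of) (by
    intro r hr
    have h : FreeGroup.lift (PresentedGroup.of (rels := {w | ModularRel d n w})) =
        PresentedGroup.mk {w | ModularRel d n w} := by
      ext a; simp [PresentedGroup.of]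
    rw [h]
    exact PresentedGroup.one_of_mem (ModularRel.framed r hr))

/-- Adding a strand on the right, on generators. -/
def Gen.castSucc {n : ℕ} : Gen n → Gen (n + 1)
  | Gen.sigma i hi => Gen.sigma i (Nat.lt_succ_of_lt hi)
  | Gen.framing j => Gen.framing j.castSucc

lemma strandSwap_castSucc {n : ℕ} (i : ℕ) (hi : i + 1 < n) (j : Fin n) :
    (strandSwap i hi j).castSucc = strandSwap i (Nat.lt_succ_of_lt hi) j.castSucc := by
  simp only [strandSwap, Equiv.swap_apply_def, Fin.ext_iff, Fin.val_castSucc]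
  split_ifs <;> simp

lemma modularRel_castSucc (d n : ℕ) (w : FreeGroup (Gen n)) (hw : ModularRel d n w) :
    ModularRel d (n + 1) (FreeGroup.map Gen.castSucc w) := by
  rcases hw with ⟨w, h⟩ | ⟨j⟩
  · refine ModularRel.framed _ ?_
    rcases h with ⟨i, hi, hj⟩ | ⟨i, j, hi, hj, hij⟩ | ⟨i, j⟩ | ⟨i, hi, j⟩
    · simpa [wordSigma, Gen.castSucc] using
        FramedRel.braid (n := n + 1) i (Nat.lt_succ_of_lt hi) (Nat.lt_succ_of_lt hj)
    · simpa [wordSigma, Gen.castSucc] using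
        FramedRel.comm (n := n + 1) i j (Nat.lt_succ_of_lt hi) (Nat.lt_succ_of_lt hj) hij
    · simpa [wordFraming, Gen.castSucc] using
        FramedRel.framing_comm (n := n + 1) i.castSucc j.castSucc
    · simpa [wordSigma, wordFraming, Gen.castSucc, strandSwap_castSucc] using
        FramedRel.framing_sigma (n := n + 1) i (Nat.lt_succ_of_lt hi) j.castSucc
  · simpa [wordFraming, Gen.castSucc] using ModularRel.modular (d := d) (n := n + 1) j.castSucc

/-- The natural inclusion `F_{d,n} → F_{d,n+1}`. -/
def addStrand (d n : ℕ) : ModularFramedBraidGroup d n →* ModularFramedBraidGroup d (n + 1) :=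
  PresentedGroup.toGroup (f := fun a => PresentedGroup.of a.castSucc) (by
    intro r hr
    have h : FreeGroup.lift (fun a : Gen n =>
          PresentedGroup.of (rels := {w | ModularRel d (n + 1) w}) a.castSucc) =
        (PresentedGroup.mk {w | ModularRel d (n + 1) w}).comp (FreeGroup.map Gen.castSucc) := by
      ext a; simp [PresentedGroup.of]
    rw [h]
    exact PresentedGroup.one_of_mem (modularRel_castSucc d n r hr))

@[simp] lemma addStrand_msigma (d : ℕ) {n : ℕ} (i : ℕ) (hi : i + 1 < n) :
    addStrand d n (msigma d i hi) = msigma d i (Nat.lt_succ_of_lt hi) := by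
  simp [addStrand, msigma, Gen.castSucc]

@[simp] lemma addStrand_mframing (d : ℕ) {n : ℕ} (j : Fin n) :
    addStrand d n (mframing d j) = mframing d j.castSucc := by
  simp [addStrand, mframing, Gen.castSucc]

/-! ### The Yokonuma–Hecke algebra -/

/-- The element `e_i = (1/d) ∑_{s=1}^{d} t_i^s t_{i+1}^{-s}` of the group algebra `ℂ F_{d,n}`. -/
def idem (d : ℕ) {n : ℕ} (i : ℕ) (hi : i + 1 < n) :
    MonoidAlgebra ℂ (ModularFramedBraidGroup d n) :=
  (1 / (d : ℂ)) • ∑ s ∈ Finset.Icc 1 d,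
    MonoidAlgebra.of ℂ (ModularFramedBraidGroup d n)
      (mframing d ⟨i, Nat.lt_of_succ_lt hi⟩ ^ s * (mframing d ⟨i + 1, hi⟩ ^ s)⁻¹)

/-- The quadratic relation `σ_i^2 = 1 + (q - q⁻¹) e_i σ_i` in `ℂ F_{d,n}`. -/
inductive QuadRel (d : ℕ) (q : ℂ) (n : ℕ) :
    MonoidAlgebra ℂ (ModularFramedBraidGroup d n) →
      MonoidAlgebra ℂ (ModularFramedBraidGroup d n) → Prop
  | quad (i : ℕ) (hi : i + 1 < n) : QuadRel d q n
      (MonoidAlgebra.of ℂ (ModularFramedBraidGroup d n) (msigma d i hi) ^ 2)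
      (1 + (q - q⁻¹) • (idem d i hi *
        MonoidAlgebra.of ℂ (ModularFramedBraidGroup d n) (msigma d i hi)))

/-- The Yokonuma–Hecke algebra `Y_{d,n}(q)`: the quotient of `ℂ F_{d,n}` by the two-sided ideal
generated by the quadratic relations. -/
abbrev YH (d : ℕ) (q : ℂ) (n : ℕ) : Type := RingQuot (QuadRel d q n)

/-- The quotient map `ℂ F_{d,n} → Y_{d,n}(q)`. -/
def toYH (d : ℕ) (q : ℂ) (n : ℕ) :
    MonoidAlgebra ℂ (ModularFramedBraidGroup d n) →ₐ[ℂ] YH d q n :=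
  RingQuot.mkAlgHom ℂ (QuadRel d q n)

/-- `g_i`, the image of `σ_i` in `Y_{d,n}(q)`. -/
def g (d : ℕ) (q : ℂ) {n : ℕ} (i : ℕ) (hi : i + 1 < n) : YH d q n :=
  toYH d q n (MonoidAlgebra.of ℂ _ (msigma d i hi))

/-- The image of `t_j` in `Y_{d,n}(q)`. -/
def t (d : ℕ) (q : ℂ) {n : ℕ} (j : Fin n) : YH d q n :=
  toYH d q n (MonoidAlgebra.of ℂ _ (mframing d j))

/-- A framed braid regarded as an element of `Y_{d,n}(q)` through the natural maps
`F_n → F_{d,n} → Y_{d,n}(q)`. -/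
def braidToYH (d : ℕ) (q : ℂ) (n : ℕ) : FramedBraidGroup n →* YH d q n :=
  ((toYH d q n : MonoidAlgebra ℂ (ModularFramedBraidGroup d n) →* YH d q n).comp
    (MonoidAlgebra.of ℂ (ModularFramedBraidGroup d n))).comp (reduceFraming d n)

/-- The inclusion `ℂ F_{d,n} → ℂ F_{d,n+1}`. -/
def groupAlgebraIncl (d n : ℕ) : MonoidAlgebra ℂ (ModularFramedBraidGroup d n) →ₐ[ℂ]
    MonoidAlgebra ℂ (ModularFramedBraidGroup d (n + 1)) :=
  MonoidAlgebra.lift ℂ _ _ ((MonoidAlgebra.of ℂ _).comp (addStrand d n))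

lemma groupAlgebraIncl_of (d n : ℕ) (x : ModularFramedBraidGroup d n) :
    groupAlgebraIncl d n (MonoidAlgebra.of ℂ _ x) = MonoidAlgebra.of ℂ _ (addStrand d n x) := by
  simp [groupAlgebraIncl]

lemma groupAlgebraIncl_idem (d : ℕ) {n : ℕ} (i : ℕ) (hi : i + 1 < n) :
    groupAlgebraIncl d n (idem d i hi) = idem d i (Nat.lt_succ_of_lt hi) := by
  simp only [idem, map_smul, map_sum, groupAlgebraIncl_of]
  simp

/-- The natural map `Y_{d,n}(q) → Y_{d,n+1}(q)`. -/
def incl (d : ℕ) (q : ℂ) (n : ℕ) : YH d q n →ₐ[ℂ] YH d q (n + 1) :=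
  RingQuot.liftAlgHom ℂ ⟨(toYH d q (n + 1)).comp (groupAlgebraIncl d n), by
    rintro _ _ ⟨i, hi⟩
    simp only [AlgHom.comp_apply, map_pow, map_add, map_one, map_smul, map_mul,
      groupAlgebraIncl_of, groupAlgebraIncl_idem, addStrand_msigma]
    have h := RingQuot.mkAlgHom_rel ℂ
      (QuadRel.quad (d := d) (q := q) (n := n + 1) i (Nat.lt_succ_of_lt hi))
    simp only [map_pow, map_add, map_one, map_smul, map_mul] at h
    exact h⟩

lemma incl_g (d : ℕ) (q : ℂ) {n : ℕ} (i : ℕ) (hi : i + 1 < n) :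
    incl d q n (g d q i hi) = g d q i (Nat.lt_succ_of_lt hi) := by
  have h : incl d q n (g d q i hi) = (toYH d q (n + 1)).comp (groupAlgebraIncl d n)
      (MonoidAlgebra.of ℂ _ (msigma d i hi)) := RingQuot.liftAlgHom_mkAlgHom_apply ..
  rw [h, AlgHom.comp_apply, groupAlgebraIncl_of, addStrand_msigma, g]

lemma incl_t (d : ℕ) (q : ℂ) {n : ℕ} (j : Fin n) :
    incl d q n (t d q j) = t d q j.castSucc := by
  have h : incl d q n (t d q j) = (toYH d q (n + 1)).comp (groupAlgebraIncl d n)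
      (MonoidAlgebra.of ℂ _ (mframing d j)) := RingQuot.liftAlgHom_mkAlgHom_apply ..
  rw [h, AlgHom.comp_apply, groupAlgebraIncl_of, addStrand_mframing, t]

lemma braidToYH_sigma (d : ℕ) (q : ℂ) {n : ℕ} (i : ℕ) (hi : i + 1 < n) :
    braidToYH d q n (sigma i hi) = g d q i hi := by
  simp [braidToYH, g, sigma, msigma, reduceFraming]

lemma braidToYH_framing (d : ℕ) (q : ℂ) {n : ℕ} (j : Fin n) :
    braidToYH d q n (framing j) = t d q j := by
  simp [braidToYH, t, framing, mframing, reduceFraming]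

/-! ### The Juyumaya trace -/

/-- The polynomial ring `ℂ[z, x_1, …, x_{d-1}]`. -/
abbrev TracePoly (d : ℕ) : Type := MvPolynomial (Option (Fin (d - 1))) ℂ

/-- The indeterminate `z`. -/
def zVar (d : ℕ) : TracePoly d := MvPolynomial.X none

/-- The indeterminate `x_s`, where `s = k + 1` runs over `1, …, d - 1`. -/
def xVar (d : ℕ) (k : Fin (d - 1)) : TracePoly d := MvPolynomial.X (some k)

/-- The rules that determine the Markov trace `tr_d`. A linear map on `⋃ n, Y_{d,n}(q)` is a
family of linear maps on the `Y_{d,n}(q)`, `n ≥ 0`, compatible with the inclusions. -/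
structure IsJuyumayaTrace (d : ℕ) (q : ℂ) (T : ∀ n : ℕ, YH d q n →ₗ[ℂ] TracePoly d) : Prop where
  map_incl : ∀ (n : ℕ) (a : YH d q n), T (n + 1) (incl d q n a) = T n a
  map_mul_comm : ∀ (n : ℕ) (a b : YH d q n), T n (a * b) = T n (b * a)
  map_one : ∀ n : ℕ, T n 1 = 1
  markov : ∀ (n : ℕ) (a : YH d q (n + 1)),
    T (n + 2) (incl d q (n + 1) a * g d q n (Nat.lt_succ_self (n + 1))) = zVar d * T (n + 1) a
  framing : ∀ (n : ℕ) (a : YH d q n) (k : Fin (d - 1)),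
    T (n + 1) (incl d q n a * t d q (Fin.last n) ^ ((k : ℕ) + 1)) = xVar d k * T n a

open Classical in
/-- The Juyumaya trace `tr_d : ⋃ n, Y_{d,n}(q) → ℂ[z, x_1, …, x_{d-1}]`: the (unique) linear map
that satisfies the trace rules. -/
def tr (d : ℕ) (q : ℂ) : ∀ n : ℕ, YH d q n →ₗ[ℂ] TracePoly d :=
  if h : ∃ T : ∀ n : ℕ, YH d q n →ₗ[ℂ] TracePoly d, IsJuyumayaTrace d q T
  then h.choose else fun _ => 0

/-! ### The E-system and the specialized traces -/

/-- `E^{(m)} = (1/d) ∑_s x_{m+s} x_{d-s}`, with indices modulo `d`. -/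
def eSum (d : ℕ) [NeZero d] (x : ZMod d → ℂ) (m : ZMod d) : ℂ :=
  (1 / (d : ℂ)) * ∑ s : ZMod d, x (m + s) * x (-s)

/-- `x_1, …, x_{d-1}` (indexed modulo `d`, with `x_0 = 1`) is a solution of the E-system
`E^{(m)} = x_m E^{(0)}`, `1 ≤ m ≤ d - 1`. -/
def IsESolution (d : ℕ) [NeZero d] (x : ZMod d → ℂ) : Prop :=
  x 0 = 1 ∧ ∀ m : ZMod d, m ≠ 0 → eSum d x m = x m * eSum d x 0

/-- The solution `X_D` of the E-system parametrized by `D ⊆ ℤ/dℤ`: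
`x_k = (1/|D|) ∑_{m ∈ D} exp(2πi m k / d)`. -/
def eSolution (d : ℕ) [NeZero d] (D : Finset (ZMod d)) : ZMod d → ℂ := fun k =>
  (1 / (D.card : ℂ)) * ∑ m ∈ D, ZMod.stdAddChar (m * k)

lemma eSum_eSolution (d : ℕ) [NeZero d] (D : Finset (ZMod d)) (m : ZMod d) :
    eSum d (eSolution d D) m = (1 / (D.card : ℂ)) * eSolution d D m := by
  have hd : (d : ℂ) ≠ 0 := Nat.cast_ne_zero.mpr (NeZero.ne d)
  have key : ∀ a b : ZMod d, ∑ s : ZMod d,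
      ZMod.stdAddChar (a * (m + s)) * (ZMod.stdAddChar (b * (-s)) : ℂ) =
      if a = b then (d : ℂ) * ZMod.stdAddChar (a * m) else 0 := by
    intro a b
    have h1 : ∀ s : ZMod d, ZMod.stdAddChar (a * (m + s)) * (ZMod.stdAddChar (b * (-s)) : ℂ) =
        ZMod.stdAddChar (a * m) * ZMod.stdAddChar (s * (a - b)) := by
      intro s
      rw [← AddChar.map_add_eq_mul, ← AddChar.map_add_eq_mul]
      congr 1; ring
    simp_rw [h1]
    rw [← Finset.mul_sum,
      AddChar.sum_mulShift (a - b) (ZMod.isPrimitive_stdAddChar d)]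
    simp only [sub_eq_zero, ZMod.card]
    split_ifs <;> simp [mul_comm]
  have h2 : ∑ s : ZMod d, eSolution d D (m + s) * eSolution d D (-s) =
      (1 / (D.card : ℂ)) ^ 2 * ∑ a ∈ D, ∑ b ∈ D, ∑ s : ZMod d,
      ZMod.stdAddChar (a * (m + s)) * (ZMod.stdAddChar (b * (-s)) : ℂ) := by
    simp only [eSolution]
    rw [Finset.sum_congr rfl (fun a _ => Finset.sum_comm), Finset.sum_comm, Finset.mul_sum]
    refine Finset.sum_congr rfl fun s _ => ?_
    rw [← Finset.sum_mul_sum]; ring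
  rw [eSum, h2]
  simp only [key, Finset.sum_ite_eq, eSolution]
  rw [Finset.sum_congr rfl (fun a ha => if_pos ha), ← Finset.mul_sum]
  field_simp

lemma isESolution_eSolution (d : ℕ) [NeZero d] (D : Finset (ZMod d)) (hD : D.Nonempty) :
    IsESolution d (eSolution d D) := by
  have hc : (D.card : ℂ) ≠ 0 := Nat.cast_ne_zero.mpr hD.card_pos.ne'
  have h0 : eSolution d D 0 = 1 := by simp [eSolution, hc]
  refine ⟨h0, fun m _ => ?_⟩
  rw [eSum_eSolution, eSum_eSolution, h0]; ring

/-- The specialization `ℂ[z, x_1, …, x_{d-1}] → ℂ[z]` at complex values of `x_1, …, x_{d-1}`. -/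
def specialize (d : ℕ) (x : ZMod d → ℂ) : TracePoly d →ₐ[ℂ] Polynomial ℂ :=
  MvPolynomial.aeval fun o : Option (Fin (d - 1)) =>
    o.elim Polynomial.X fun k => Polynomial.C (x (((k : ℕ) + 1 : ℕ) : ZMod d))

/-- The trace `tr_d` with the parameters `x_1, …, x_{d-1}` specialized to complex numbers. -/
def specializedTr (d : ℕ) (q : ℂ) (x : ZMod d → ℂ) (n : ℕ) : YH d q n →ₗ[ℂ] Polynomial ℂ :=
  (specialize d x).toLinearMap.comp (tr d q n)

/-- The specialized trace `tr_{d,D}`. -/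
def trD (d : ℕ) [NeZero d] (q : ℂ) (D : Finset (ZMod d)) (n : ℕ) :
    YH d q n →ₗ[ℂ] Polynomial ℂ :=
  specializedTr d q (eSolution d D) n

/-- The framed braids in `F_n` that involve only the strands `a, …, b - 1`: the subgroup
generated by the `σ_i` and `t_j` on these strands. -/
def strandBlock (n a b : ℕ) : Subgroup (FramedBraidGroup n) :=
  Subgroup.closure ({w | ∃ (i : ℕ) (hi : i + 1 < n), a ≤ i ∧ i + 1 < b ∧ w = sigma i hi} ∪
    {w | ∃ j : Fin n, a ≤ (j : ℕ) ∧ (j : ℕ) < b ∧ w = framing j})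

end YokonumaHecke

end

/-!
Let `Y_l` be the image in `Y_{d,n}(q)` of the braids on the first `l` strands. The quadratic
relation reduces every braid on the strands `k + 1, …, l + 1` to a combination of elements `v t^s`
and `u σ_l v`, where `t` is the framing of the last strand and `u`, `v` live on the strands
`k + 1, …, l`. The trace rules evaluate `a v t^s` and `a u σ_l v` in terms of `a v` and `a u v` for
every `a` in `Y_k`, so `tr_d (a b) = tr_d a * tr_d b` follows by induction on `l`.

A trace exists because the R-matrices of the Hecke algebras, coloured by the characters of `ℤ/dℤ`,
represent the Yokonuma–Hecke algebras on tensor powers. Weighted traces of these representations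
satisfy the trace rules for infinitely many values of each parameter, hence they all come from one
trace with generic parameters, which then specializes to any ring.
-/

noncomputable section

namespace YokonumaHecke

variable {d n : ℕ}

/-! ### Relations between framed braids -/

lemma mk_eq_mk_of_framedRel {u v : FreeGroup (Gen n)} (h : FramedRel n (u * v⁻¹)) :
    PresentedGroup.mk {w | ModularRel d n w} u = PresentedGroup.mk {w | ModularRel d n w} v :=
  PresentedGroup.mk_eq_mk_of_mul_inv_mem (ModularRel.framed _ h)

lemma mframing_pow_eq_one (j : Fin n) : mframing d j ^ d = 1 :=
  PresentedGroup.one_of_mem (ModularRel.modular j)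

lemma commute_mframing (i j : Fin n) : Commute (mframing d i) (mframing d j) :=
  mk_eq_mk_of_framedRel (FramedRel.framing_comm i j)

lemma msigma_braid (i : ℕ) (hi : i + 1 < n) (hj : i + 1 + 1 < n) :
    msigma d i hi * msigma d (i + 1) hj * msigma d i hi =
      msigma d (i + 1) hj * msigma d i hi * msigma d (i + 1) hj :=
  mk_eq_mk_of_framedRel (FramedRel.braid i hi hj)

lemma commute_msigma {i j : ℕ} (hi : i + 1 < n) (hj : j + 1 < n) (hij : i + 1 < j) :
    Commute (msigma d i hi) (msigma d j hj) :=
  mk_eq_mk_of_framedRel (FramedRel.comm i j hi hj hij)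

lemma semiconjBy_msigma (i : ℕ) (hi : i + 1 < n) (j : Fin n) :
    SemiconjBy (msigma d i hi) (mframing d (strandSwap i hi j)) (mframing d j) :=
  (mk_eq_mk_of_framedRel (FramedRel.framing_sigma i hi j)).symm

lemma strandSwap_left (i : ℕ) (hi : i + 1 < n) :
    strandSwap i hi ⟨i, Nat.lt_of_succ_lt hi⟩ = ⟨i + 1, hi⟩ := Equiv.swap_apply_left _ _

lemma strandSwap_right (i : ℕ) (hi : i + 1 < n) :
    strandSwap i hi ⟨i + 1, hi⟩ = ⟨i, Nat.lt_of_succ_lt hi⟩ := Equiv.swap_apply_right _ _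

lemma strandSwap_of_ne {i : ℕ} (hi : i + 1 < n) {j : Fin n} (h : (j : ℕ) ≠ i)
    (h' : (j : ℕ) ≠ i + 1) : strandSwap i hi j = j :=
  Equiv.swap_apply_of_ne_of_ne (fun e => h (congrArg Fin.val e)) fun e => h' (congrArg Fin.val e)

lemma semiconjBy_msigma_left (i : ℕ) (hi : i + 1 < n) :
    SemiconjBy (msigma d i hi) (mframing d ⟨i + 1, hi⟩)
      (mframing d ⟨i, Nat.lt_of_succ_lt hi⟩) := by
  simpa only [strandSwap_left] using semiconjBy_msigma (d := d) i hi ⟨i, Nat.lt_of_succ_lt hi⟩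

lemma semiconjBy_msigma_right (i : ℕ) (hi : i + 1 < n) :
    SemiconjBy (msigma d i hi) (mframing d ⟨i, Nat.lt_of_succ_lt hi⟩)
      (mframing d ⟨i + 1, hi⟩) := by
  simpa only [strandSwap_right] using semiconjBy_msigma (d := d) i hi ⟨i + 1, hi⟩

lemma commute_msigma_mframing {i : ℕ} (hi : i + 1 < n) {j : Fin n} (h : (j : ℕ) ≠ i)
    (h' : (j : ℕ) ≠ i + 1) : Commute (msigma d i hi) (mframing d j) := by
  have hσ := semiconjBy_msigma (d := d) i hi j
  rwa [strandSwap_of_ne hi h h'] at hσ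

/-! ### Subgroups of strands -/

variable (d n) in
/-- The modular framed braids that involve only the strands `a, …, b - 1`. -/
def strandGroup (a b : ℕ) : Subgroup (ModularFramedBraidGroup d n) :=
  Subgroup.closure ({w | ∃ (i : ℕ) (hi : i + 1 < n), a ≤ i ∧ i + 1 < b ∧ w = msigma d i hi} ∪
    {w | ∃ j : Fin n, a ≤ (j : ℕ) ∧ (j : ℕ) < b ∧ w = mframing d j})

lemma msigma_mem_strandGroup {a b i : ℕ} (hi : i + 1 < n) (ha : a ≤ i) (hb : i + 1 < b) :
    msigma d i hi ∈ strandGroup d n a b :=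
  Subgroup.subset_closure (Or.inl ⟨i, hi, ha, hb, rfl⟩)

lemma mframing_mem_strandGroup {a b : ℕ} {j : Fin n} (ha : a ≤ (j : ℕ)) (hb : (j : ℕ) < b) :
    mframing d j ∈ strandGroup d n a b :=
  Subgroup.subset_closure (Or.inr ⟨j, ha, hb, rfl⟩)

lemma strandGroup_le_iff {a b : ℕ} {H : Subgroup (ModularFramedBraidGroup d n)} :
    strandGroup d n a b ≤ H ↔
      (∀ (i : ℕ) (hi : i + 1 < n), a ≤ i → i + 1 < b → msigma d i hi ∈ H) ∧
        ∀ j : Fin n, a ≤ (j : ℕ) → (j : ℕ) < b → mframing d j ∈ H := by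
  rw [strandGroup, Subgroup.closure_le, Set.union_subset_iff]
  refine and_congr ⟨fun h i hi ha hb => h ⟨i, hi, ha, hb, rfl⟩, ?_⟩
    ⟨fun h j ha hb => h ⟨j, ha, hb, rfl⟩, ?_⟩
  · rintro h _ ⟨i, hi, ha, hb, rfl⟩
    exact h i hi ha hb
  · rintro h _ ⟨j, ha, hb, rfl⟩
    exact h j ha hb

lemma strandGroup_mono {a a' b b' : ℕ} (ha : a' ≤ a) (hb : b ≤ b') :
    strandGroup d n a b ≤ strandGroup d n a' b' :=
  strandGroup_le_iff.2
    ⟨fun _ hi h h' => msigma_mem_strandGroup hi (ha.trans h) (h'.trans_le hb),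
      fun _ h h' => mframing_mem_strandGroup (ha.trans h) (h'.trans_le hb)⟩

lemma strandGroup_self (a : ℕ) : strandGroup d n a a = ⊥ :=
  le_bot_iff.1 <| strandGroup_le_iff.2 ⟨fun _ _ _ _ => by omega, fun _ _ _ => by omega⟩

lemma strandGroup_zero_self : strandGroup d n 0 n = ⊤ := by
  refine top_le_iff.1 ((PresentedGroup.closure_range_of _).symm.le.trans ?_)
  rw [Subgroup.closure_le]
  rintro _ ⟨i | j, rfl⟩
  · exact msigma_mem_strandGroup _ (Nat.zero_le _) ‹_›
  · exact mframing_mem_strandGroup (Nat.zero_le _) j.is_lt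

lemma commute_msigma_of_mem_strandGroup {a b i : ℕ} (hi : i + 1 < n) (hb : b ≤ i)
    {x : ModularFramedBraidGroup d n} (hx : x ∈ strandGroup d n a b) :
    Commute (msigma d i hi) x := by
  refine (Subgroup.mem_centralizer_singleton_iff.1 (strandGroup_le_iff.2 ⟨?_, ?_⟩ hx)).symm
  · exact fun j hj _ h =>
      Subgroup.mem_centralizer_singleton_iff.2 (commute_msigma hj hi (h.trans_le hb))
  · exact fun j _ h => Subgroup.mem_centralizer_singleton_iff.2
      (commute_msigma_mframing hi (by omega) (by omega)).symm

lemma commute_mframing_of_mem_strandGroup {a b : ℕ} {j : Fin n} (hb : b ≤ (j : ℕ))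
    {x : ModularFramedBraidGroup d n} (hx : x ∈ strandGroup d n a b) :
    Commute (mframing d j) x := by
  refine (Subgroup.mem_centralizer_singleton_iff.1 (strandGroup_le_iff.2 ⟨?_, ?_⟩ hx)).symm
  · exact fun i hi _ h => Subgroup.mem_centralizer_singleton_iff.2
      (commute_msigma_mframing hi (by omega) (by omega))
  · exact fun i _ _ => Subgroup.mem_centralizer_singleton_iff.2 (commute_mframing i j)

lemma map_addStrand_strandGroup {a b : ℕ} (hb : b ≤ n) :
    (strandGroup d n a b).map (addStrand d n) = strandGroup d (n + 1) a b := by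
  refine le_antisymm (Subgroup.map_le_iff_le_comap.2 (strandGroup_le_iff.2 ⟨?_, ?_⟩))
    (strandGroup_le_iff.2 ⟨?_, ?_⟩)
  · intro i hi ha hib
    rw [Subgroup.mem_comap, addStrand_msigma]
    exact msigma_mem_strandGroup _ ha hib
  · intro j ha hjb
    rw [Subgroup.mem_comap, addStrand_mframing]
    exact mframing_mem_strandGroup ha hjb
  · exact fun i hi ha hib => ⟨_, msigma_mem_strandGroup (hib.trans_le hb) ha hib, by simp⟩
  · exact fun j ha hjb => ⟨_, mframing_mem_strandGroup (j := j.castLT (hjb.trans_le hb)) ha hjb,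
      by rw [addStrand_mframing, Fin.castSucc_castLT]⟩

lemma reduceFraming_mem_strandGroup {a b : ℕ} {w : FramedBraidGroup n}
    (hw : w ∈ strandBlock n a b) : reduceFraming d n w ∈ strandGroup d n a b := by
  refine (Subgroup.closure_le (strandGroup d n a b |>.comap (reduceFraming d n))).2 ?_ hw
  rintro _ (⟨i, hi, ha, hb, rfl⟩ | ⟨j, ha, hb, rfl⟩)
  · rw [SetLike.mem_coe, Subgroup.mem_comap, reduceFraming, sigma, PresentedGroup.toGroup.of]
    exact msigma_mem_strandGroup hi ha hb
  · rw [SetLike.mem_coe, Subgroup.mem_comap, reduceFraming, framing, PresentedGroup.toGroup.of]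
    exact mframing_mem_strandGroup ha hb

/-! ### Spanning by cosets -/

variable (d n) in
/-- The spanning set `W t_l^s ∪ W σ_{l-1} W` of the Yokonuma–Hecke algebra on the strands
`k, …, l`, where `W` is the group of the strands `k, …, l - 1`. -/
def strandCosets (k l : ℕ) : Set (ModularFramedBraidGroup d n) :=
  {w | ∃ (hl : l < n) (s : ℤ), ∃ x ∈ strandGroup d n k l, w = x * mframing d ⟨l, hl⟩ ^ s} ∪
    {w | ∃ (i : ℕ) (hi : i + 1 < n), k ≤ i ∧ i + 1 = l ∧
      ∃ x ∈ strandGroup d n k l, ∃ y ∈ strandGroup d n k l, w = x * msigma d i hi * y}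

lemma mul_mframing_mem_strandCosets {k l : ℕ} (hl : l < n) {x : ModularFramedBraidGroup d n}
    (hx : x ∈ strandGroup d n k l) (s : ℤ) :
    x * mframing d ⟨l, hl⟩ ^ s ∈ strandCosets d n k l := Or.inl ⟨hl, s, x, hx, rfl⟩

lemma mul_msigma_mul_mem_strandCosets {k i : ℕ} (hi : i + 1 < n) (hk : k ≤ i)
    {x y : ModularFramedBraidGroup d n} (hx : x ∈ strandGroup d n k (i + 1))
    (hy : y ∈ strandGroup d n k (i + 1)) :
    x * msigma d i hi * y ∈ strandCosets d n k (i + 1) :=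
  Or.inr ⟨i, hi, hk, rfl, x, hx, y, hy, rfl⟩

lemma mul_mem_strandCosets {k l : ℕ} {x w : ModularFramedBraidGroup d n}
    (hx : x ∈ strandGroup d n k l) (hw : w ∈ strandCosets d n k l) :
    x * w ∈ strandCosets d n k l := by
  obtain ⟨hl, s, y, hy, rfl⟩ | ⟨i, hi, hk, rfl, y, hy, v, hv, rfl⟩ := hw
  · simpa only [mul_assoc] using mul_mframing_mem_strandCosets hl (mul_mem hx hy) s
  · simpa only [mul_assoc] using mul_msigma_mul_mem_strandCosets hi hk (mul_mem hx hy) hv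

lemma mframing_zpow_mul_mem_strandCosets {k l : ℕ} (hl : l < n) (s : ℤ)
    {w : ModularFramedBraidGroup d n} (hw : w ∈ strandCosets d n k l) :
    mframing d ⟨l, hl⟩ ^ s * w ∈ strandCosets d n k l := by
  obtain ⟨_, s', x, hx, rfl⟩ | ⟨i, hi, hk, rfl, x, hx, y, hy, rfl⟩ := hw
  · have hcomm := (commute_mframing_of_mem_strandGroup (j := ⟨l, hl⟩) le_rfl hx).zpow_left s
    rw [← mul_assoc, hcomm.eq, mul_assoc, ← zpow_add]
    exact mul_mframing_mem_strandCosets hl hx _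
  · have hcomm := (commute_mframing_of_mem_strandGroup (j := ⟨i + 1, hl⟩) le_rfl hx).zpow_left s
    have hswap := (semiconjBy_msigma_right (d := d) i hi).zpow_right s
    rw [mul_assoc, ← mul_assoc, hcomm.eq, mul_assoc, ← mul_assoc _ _ y, ← hswap.eq, mul_assoc,
      ← mul_assoc]
    exact mul_msigma_mul_mem_strandCosets hi hk hx
      (mul_mem (zpow_mem (mframing_mem_strandGroup hk (Nat.lt_succ_self i)) s) hy)

/-- A function on the framed braids that factors through the quadratic relation of the
Yokonuma–Hecke algebra; `r` stands for `(q - q⁻¹) / d`. -/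
def IsQuadratic {A M : Type*} [CommRing A] [AddCommGroup M] [Module A M] (r : A)
    (f : ModularFramedBraidGroup d n → M) : Prop :=
  ∀ (i : ℕ) (hi : i + 1 < n) (v w : ModularFramedBraidGroup d n),
    f (v * msigma d i hi ^ 2 * w) = f (v * w) + r • ∑ s ∈ Finset.Icc 1 d,
      f (v * (mframing d ⟨i, Nat.lt_of_succ_lt hi⟩ ^ s * (mframing d ⟨i + 1, hi⟩ ^ s)⁻¹ *
        msigma d i hi) * w)

namespace IsQuadratic

variable {A M : Type*} [CommRing A] [AddCommGroup M] [Module A M] {r : A}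
  {f : ModularFramedBraidGroup d n → M}

lemma comp_mul_mul (hf : IsQuadratic r f) (x y : ModularFramedBraidGroup d n) :
    IsQuadratic r fun w => f (x * w * y) := fun i hi v w => by
  simpa only [mul_assoc] using hf i hi (x * v) (w * y)

lemma map_msigma_inv_mul (hf : IsQuadratic r f) {i : ℕ} (hi : i + 1 < n)
    (w : ModularFramedBraidGroup d n) :
    f ((msigma d i hi)⁻¹ * w) = f (msigma d i hi * w) - r • ∑ s ∈ Finset.Icc 1 d,
      f (mframing d ⟨i + 1, hi⟩ ^ s * ((mframing d ⟨i, Nat.lt_of_succ_lt hi⟩ ^ s)⁻¹ * w)) := by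
  have h := hf i hi (msigma d i hi)⁻¹ w
  rw [pow_two, inv_mul_cancel_left] at h
  rw [h, eq_sub_iff_add_eq, add_right_inj]
  refine congrArg (r • ·) (Finset.sum_congr rfl fun s _ => congrArg f ?_)
  have hleft := (semiconjBy_msigma_left (d := d) i hi).pow_right s
  have hright := ((semiconjBy_msigma_right (d := d) i hi).pow_right s).inv_right
  rw [← mul_assoc (_ ^ s) _ w, mul_left_inj, eq_inv_mul_iff_mul_eq]
  exact (hleft.mul_right hright).eq

end IsQuadratic

variable {d n : ℕ}

lemma mem_strandCosets_of_mem_strandGroup {k l : ℕ} (hl : l < n)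
    {x : ModularFramedBraidGroup d n} (hx : x ∈ strandGroup d n k l) :
    x ∈ strandCosets d n k l := by
  simpa only [zpow_zero, mul_one] using mul_mframing_mem_strandCosets hl hx 0

lemma msigma_mul_mem_strandCosets {k i : ℕ} (hi : i + 1 < n) (hk : k ≤ i)
    {y : ModularFramedBraidGroup d n} (hy : y ∈ strandGroup d n k (i + 1)) :
    msigma d i hi * y ∈ strandCosets d n k (i + 1) := by
  simpa only [one_mul] using mul_msigma_mul_mem_strandCosets hi hk (one_mem _) hy

lemma mframing_pow_mul_inv_mul_mem_strandCosets {k i : ℕ} (hi : i + 1 < n) (hk : k ≤ i) (s : ℕ)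
    {w : ModularFramedBraidGroup d n} (hw : w ∈ strandCosets d n k (i + 1)) :
    mframing d ⟨i + 1, hi⟩ ^ s * ((mframing d ⟨i, Nat.lt_of_succ_lt hi⟩ ^ s)⁻¹ * w) ∈
      strandCosets d n k (i + 1) := by
  rw [← zpow_natCast (mframing d ⟨i + 1, hi⟩)]
  exact mframing_zpow_mul_mem_strandCosets hi _ <| mul_mem_strandCosets
    (inv_mem (pow_mem (mframing_mem_strandGroup hk (Nat.lt_succ_self i)) s)) hw

variable {A M : Type*} [CommRing A] [AddCommGroup M] [Module A M] {r : A}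
  {f : ModularFramedBraidGroup d n → M}

variable (d n M r) in
/-- The framed braids `g` such that left multiplication by `g` and by `g⁻¹` maps `strandCosets`
into its linear span modulo the quadratic relation. The quotient algebra is encoded by the
functions that factor through it. -/
def cosetStabilizer (k l : ℕ) : Subgroup (ModularFramedBraidGroup d n) where
  carrier := {g | ∀ f : ModularFramedBraidGroup d n → M, IsQuadratic r f →
    ∀ c ∈ strandCosets d n k l, f (g * c) ∈ Submodule.span A (f '' strandCosets d n k l) ∧
      f (g⁻¹ * c) ∈ Submodule.span A (f '' strandCosets d n k l)}
  one_mem' f _ c hc := by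
    simpa using Submodule.subset_span (Set.mem_image_of_mem f hc)
  inv_mem' hg f hf c hc := by simpa only [inv_inv] using (hg f hf c hc).symm
  mul_mem' {g h} hg hh f hf c hc := by
    have hle (x : ModularFramedBraidGroup d n)
        (hx : ∀ c ∈ strandCosets d n k l,
          f (x * c) ∈ Submodule.span A (f '' strandCosets d n k l)) :
        Submodule.span A ((fun w => f (x * w * 1)) '' strandCosets d n k l) ≤
          Submodule.span A (f '' strandCosets d n k l) := by
      rw [Submodule.span_le]
      rintro _ ⟨c, hc, rfl⟩
      simpa only [mul_one, SetLike.mem_coe] using hx c hc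
    have hgh := hle g (fun c hc => (hg f hf c hc).1) (hh _ (hf.comp_mul_mul g 1) c hc).1
    have hhg := hle h⁻¹ (fun c hc => (hh f hf c hc).2) (hg _ (hf.comp_mul_mul h⁻¹ 1) c hc).2
    rw [mul_inv_rev]
    simpa only [mul_one, mul_assoc] using And.intro hgh hhg

lemma apply_mem_span_of_mem_cosetStabilizer {k l : ℕ} (hl : l < n)
    {w : ModularFramedBraidGroup d n} (hw : w ∈ cosetStabilizer d n M r k l)
    (hf : IsQuadratic r f) : f w ∈ Submodule.span A (f '' strandCosets d n k l) := by
  simpa only [mul_one] using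
    (hw f hf 1 (mem_strandCosets_of_mem_strandGroup hl (one_mem _))).1

lemma mem_cosetStabilizer_of_forall_mul_mem {k l : ℕ} {g : ModularFramedBraidGroup d n}
    (hg : ∀ c ∈ strandCosets d n k l, g * c ∈ strandCosets d n k l ∧
      g⁻¹ * c ∈ strandCosets d n k l) : g ∈ cosetStabilizer d n M r k l :=
  fun f _ c hc => ⟨Submodule.subset_span (Set.mem_image_of_mem f (hg c hc).1),
    Submodule.subset_span (Set.mem_image_of_mem f (hg c hc).2)⟩

lemma msigma_mul_mframing_mul_msigma {k i : ℕ} (hi : i + 1 < n) {x : ModularFramedBraidGroup d n}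
    (hx : x ∈ strandGroup d n k i) (s : ℤ) (y : ModularFramedBraidGroup d n) :
    msigma d i hi * (x * mframing d ⟨i, Nat.lt_of_succ_lt hi⟩ ^ s) * (msigma d i hi * y) =
      x * mframing d ⟨i + 1, hi⟩ ^ s * msigma d i hi ^ 2 * y := by
  rw [← mul_assoc (msigma d i hi) x, (commute_msigma_of_mem_strandGroup hi le_rfl hx).eq,
    mul_assoc x, ((semiconjBy_msigma_right (d := d) i hi).zpow_right s).eq, pow_two]
  simp only [mul_assoc]

lemma msigma_mul_msigma_mul_msigma {k j : ℕ} (hj : j + 1 < n) (hj' : j + 1 + 1 < n)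
    {x x' : ModularFramedBraidGroup d n} (hx : x ∈ strandGroup d n k (j + 1))
    (hx' : x' ∈ strandGroup d n k (j + 1)) (y : ModularFramedBraidGroup d n) :
    msigma d (j + 1) hj' * (x * msigma d j hj * x') * (msigma d (j + 1) hj' * y) =
      x * msigma d j hj * msigma d (j + 1) hj' * (msigma d j hj * x' * y) := by
  have hcomm := (commute_msigma_of_mem_strandGroup hj' le_rfl hx).eq
  have hcomm' := (commute_msigma_of_mem_strandGroup hj' le_rfl hx').eq
  calc
    _ = msigma d (j + 1) hj' * x * msigma d j hj * (x' * msigma d (j + 1) hj') * y := by group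
    _ = x * (msigma d (j + 1) hj' * msigma d j hj * msigma d (j + 1) hj') * x' * y := by
      rw [hcomm, ← hcomm']; group
    _ = _ := by rw [← msigma_braid j hj hj']; group

namespace IsQuadratic

lemma sub {g : ModularFramedBraidGroup d n → M} (hf : IsQuadratic r f) (hg : IsQuadratic r g) :
    IsQuadratic r (f - g) := fun i hi v w => by
  simp only [Pi.sub_apply, hf i hi v w, hg i hi v w, Finset.sum_sub_distrib, smul_sub]
  abel

lemma const_smul (hf : IsQuadratic r f) (a : A) : IsQuadratic r (a • f) := fun i hi v w => by
  simp only [Pi.smul_apply, hf i hi v w, smul_add, ← Finset.smul_sum, smul_comm a r]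

lemma map_msigma_mul_coset_mul_msigma_mem_span (hf : IsQuadratic r f) {k i : ℕ} (hi : i + 1 < n)
    (hk : k ≤ i) {v y : ModularFramedBraidGroup d n} (hv : v ∈ strandCosets d n k i)
    (hy : y ∈ strandGroup d n k (i + 1)) :
    f (msigma d i hi * v * (msigma d i hi * y)) ∈
      Submodule.span A (f '' strandCosets d n k (i + 1)) := by
  have hmono := strandGroup_mono (d := d) (n := n) (le_refl k) (Nat.le_succ i)
  have hspan {w} (hw : w ∈ strandCosets d n k (i + 1)) :
      f w ∈ Submodule.span A (f '' strandCosets d n k (i + 1)) :=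
    Submodule.subset_span (Set.mem_image_of_mem f hw)
  obtain ⟨hin, s, x, hx, rfl⟩ | ⟨j, hj, hkj, rfl, x, hx, x', hx', rfl⟩ := hv
  · rw [msigma_mul_mframing_mul_msigma hi hx, hf i hi, mul_assoc x]
    refine add_mem (hspan <| mul_mem_strandCosets (hmono hx) <|
      mframing_zpow_mul_mem_strandCosets hi s <| mem_strandCosets_of_mem_strandGroup hi hy)
      (Submodule.smul_mem _ _ <| sum_mem fun a _ => hspan ?_)
    simp only [mul_assoc]
    rw [← zpow_natCast (mframing d ⟨i + 1, hi⟩) a, ← zpow_neg]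
    exact mul_mem_strandCosets (hmono hx) <| mframing_zpow_mul_mem_strandCosets hi s <|
      mul_mem_strandCosets (pow_mem (mframing_mem_strandGroup hk (Nat.lt_succ_self i)) a) <|
      mframing_zpow_mul_mem_strandCosets hi _ <| msigma_mul_mem_strandCosets hi hk hy
  · have hσ : msigma d j hj ∈ strandGroup d n k (j + 1 + 1) :=
      msigma_mem_strandGroup hj hkj (Nat.lt_succ_self _)
    rw [msigma_mul_msigma_mul_msigma hj hi hx hx']
    exact hspan <| mul_msigma_mul_mem_strandCosets hi hk (mul_mem (hmono hx) hσ)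
      (mul_mem (mul_mem hσ (hmono hx')) hy)

lemma map_msigma_mul_mem_span (hf : IsQuadratic r f) {k i : ℕ} (hi : i + 1 < n) (hk : k ≤ i)
    (ih : strandGroup d n k (i + 1) ≤ cosetStabilizer d n M r k i)
    {w : ModularFramedBraidGroup d n} (hw : w ∈ strandCosets d n k (i + 1)) :
    f (msigma d i hi * w) ∈ Submodule.span A (f '' strandCosets d n k (i + 1)) := by
  obtain ⟨_, s, x, hx, rfl⟩ | ⟨j, hj, _, hji, x, hx, y, hy, rfl⟩ := hw
  · refine Submodule.subset_span (Set.mem_image_of_mem f ?_)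
    have hcomm := (commute_mframing_of_mem_strandGroup (j := ⟨i + 1, hi⟩) le_rfl hx).zpow_left s
    rw [← hcomm.eq, ← mul_assoc, ((semiconjBy_msigma_left (d := d) i hi).zpow_right s).eq]
    exact mul_msigma_mul_mem_strandCosets hi hk
      (zpow_mem (mframing_mem_strandGroup hk (Nat.lt_succ_self i)) s) hx
  · obtain rfl : j = i := Nat.succ_injective hji
    have hx := apply_mem_span_of_mem_cosetStabilizer (Nat.lt_of_succ_lt hi) (ih hx)
      (hf.comp_mul_mul (msigma d j hi) (msigma d j hi * y))
    rw [mul_assoc x, ← mul_assoc]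
    refine Submodule.span_le.2 ?_ hx
    rintro _ ⟨v, hv, rfl⟩
    exact hf.map_msigma_mul_coset_mul_msigma_mem_span hi hk hv hy

lemma map_msigma_inv_mul_mem_span (hf : IsQuadratic r f) {k i : ℕ} (hi : i + 1 < n) (hk : k ≤ i)
    (ih : strandGroup d n k (i + 1) ≤ cosetStabilizer d n M r k i)
    {w : ModularFramedBraidGroup d n} (hw : w ∈ strandCosets d n k (i + 1)) :
    f ((msigma d i hi)⁻¹ * w) ∈ Submodule.span A (f '' strandCosets d n k (i + 1)) := by
  rw [hf.map_msigma_inv_mul hi]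
  exact sub_mem (hf.map_msigma_mul_mem_span hi hk ih hw) <| Submodule.smul_mem _ _ <|
    sum_mem fun s _ => Submodule.subset_span <| Set.mem_image_of_mem f <|
      mframing_pow_mul_inv_mul_mem_strandCosets hi hk s hw

end IsQuadratic

lemma mem_cosetStabilizer_of_mem_strandGroup {k l : ℕ} {x : ModularFramedBraidGroup d n}
    (hx : x ∈ strandGroup d n k l) : x ∈ cosetStabilizer d n M r k l :=
  mem_cosetStabilizer_of_forall_mul_mem fun _ hc =>
    ⟨mul_mem_strandCosets hx hc, mul_mem_strandCosets (inv_mem hx) hc⟩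

lemma mframing_mem_cosetStabilizer {k l : ℕ} (hl : l < n) :
    mframing d ⟨l, hl⟩ ∈ cosetStabilizer d n M r k l :=
  mem_cosetStabilizer_of_forall_mul_mem fun _ hc =>
    ⟨by simpa only [zpow_one] using mframing_zpow_mul_mem_strandCosets hl 1 hc,
      by simpa only [zpow_neg_one] using mframing_zpow_mul_mem_strandCosets hl (-1) hc⟩

theorem strandGroup_le_cosetStabilizer {k l : ℕ} (hl : l < n) :
    strandGroup d n k (l + 1) ≤ cosetStabilizer d n M r k l := by
  induction l using Nat.strong_induction_on with
  | _ l ih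
  refine strandGroup_le_iff.2 ⟨fun i hi hk hil => ?_, fun j hk hjl => ?_⟩
  · obtain hil | rfl := (Nat.lt_succ_iff.1 hil).lt_or_eq
    · exact mem_cosetStabilizer_of_mem_strandGroup (msigma_mem_strandGroup hi hk hil)
    · have ih := ih i (Nat.lt_succ_self i) (Nat.lt_of_succ_lt hi)
      exact fun f hf c hc => ⟨hf.map_msigma_mul_mem_span hi hk ih hc,
        hf.map_msigma_inv_mul_mem_span hi hk ih hc⟩
  · obtain hjl | rfl := (Nat.lt_succ_iff.1 hjl).lt_or_eq
    · exact mem_cosetStabilizer_of_mem_strandGroup (mframing_mem_strandGroup hk hjl)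
    · exact mframing_mem_cosetStabilizer hl

theorem IsQuadratic.apply_mem_span_strandCosets (hf : IsQuadratic r f) {k l : ℕ} (hl : l < n)
    {w : ModularFramedBraidGroup d n} (hw : w ∈ strandGroup d n k (l + 1)) :
    f w ∈ Submodule.span A (f '' strandCosets d n k l) :=
  apply_mem_span_of_mem_cosetStabilizer hl (strandGroup_le_cosetStabilizer hl hw) hf

theorem IsQuadratic.eqOn_strandGroup {f g : ModularFramedBraidGroup d n → M}
    (hf : IsQuadratic r f) (hg : IsQuadratic r g) {k l : ℕ} (hl : l < n)
    (hfg : Set.EqOn f g (strandCosets d n k l)) :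
    Set.EqOn f g (strandGroup d n k (l + 1)) := fun w hw => by
  have hzero : (f - g) '' strandCosets d n k l ⊆ {0} := by
    rintro _ ⟨c, hc, rfl⟩
    exact sub_eq_zero.2 (hfg hc)
  have hspan := Submodule.span_mono hzero ((hf.sub hg).apply_mem_span_strandCosets hl hw)
  rw [Submodule.span_zero_singleton, Submodule.mem_bot] at hspan
  exact sub_eq_zero.1 hspan

variable {d n : ℕ}

/-! ### Markov traces -/

/-- The trace rules for functions on the groups `F_{d,n}` with values in an arbitrary commutative
ring `A`, where `r` stands for `(q - q⁻¹) / d`. The parameters `x_s` are indexed by `ℤ/dℤ`,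
and `x_0 = 1` is not imposed: it expresses compatibility with adding a strand. -/
structure IsMarkovTrace (d : ℕ) {A : Type*} [CommRing A] (r z : A) (x : ZMod d → A)
    (τ : ∀ n, ModularFramedBraidGroup d n → A) : Prop where
  isQuadratic : ∀ n, IsQuadratic r (τ n)
  map_mul_comm : ∀ n v w, τ n (v * w) = τ n (w * v)
  map_one_zero : τ 0 1 = 1
  markov : ∀ n w, τ (n + 2) (addStrand d (n + 1) w * msigma d n (Nat.lt_succ_self (n + 1))) =
    z * τ (n + 1) w
  framing : ∀ n w (s : ℤ), τ (n + 1) (addStrand d n w * mframing d (Fin.last n) ^ s) =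
    x s * τ n w

namespace IsMarkovTrace

section Values

variable {A B : Type*} [CommRing A] [CommRing B] {r z : A} {x : ZMod d → A}
  {τ : ∀ n, ModularFramedBraidGroup d n → A}

lemma map_mul_cycle (hτ : IsMarkovTrace d r z x τ) (u v w : ModularFramedBraidGroup d n) :
    τ n (u * v * w) = τ n (w * u * v) := by
  rw [hτ.map_mul_comm, mul_assoc]

lemma map (hτ : IsMarkovTrace d r z x τ) (φ : A →+* B) :
    IsMarkovTrace d (φ r) (φ z) (fun s => φ (x s)) fun n w => φ (τ n w) where
  isQuadratic n i hi v w := by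
    simpa only [map_add, map_mul, map_sum, smul_eq_mul] using
      congrArg φ (hτ.isQuadratic n i hi v w)
  map_mul_comm n v w := congrArg φ (hτ.map_mul_comm n v w)
  map_one_zero := by rw [hτ.map_one_zero, map_one]
  markov n w := by rw [hτ.markov, map_mul]
  framing n w s := by rw [hτ.framing, map_mul]

lemma of_map_injective {φ : A →+* B} (hφ : Function.Injective φ)
    (hτ : IsMarkovTrace d (φ r) (φ z) (fun s => φ (x s)) fun n w => φ (τ n w)) :
    IsMarkovTrace d r z x τ where
  isQuadratic n i hi v w := hφ <| by
    simpa only [map_add, map_mul, map_sum, smul_eq_mul] using hτ.isQuadratic n i hi v w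
  map_mul_comm n v w := hφ (hτ.map_mul_comm n v w)
  map_one_zero := hφ <| by rw [hτ.map_one_zero, map_one]
  markov n w := hφ <| by rw [hτ.markov, map_mul]
  framing n w s := hφ <| by rw [hτ.framing, map_mul]

lemma pi {Θ : Type*} {r z : Θ → A} {x : ZMod d → Θ → A}
    {τ : ∀ n, ModularFramedBraidGroup d n → Θ → A}
    (hτ : ∀ θ, IsMarkovTrace d (r θ) (z θ) (fun s => x s θ) fun n w => τ n w θ) :
    IsMarkovTrace d r z x τ where
  isQuadratic n i hi v w := funext fun θ => by
    simpa only [Pi.add_apply, Pi.smul_apply', Pi.smul_apply, Finset.sum_apply] using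
      (hτ θ).isQuadratic n i hi v w
  map_mul_comm n v w := funext fun θ => (hτ θ).map_mul_comm n v w
  map_one_zero := funext fun θ => (hτ θ).map_one_zero
  markov n w := funext fun θ => (hτ θ).markov n w
  framing n w s := funext fun θ => (hτ θ).framing n w s

theorem apply_mem_bot [Algebra A B] {τ : ∀ n, ModularFramedBraidGroup d n → B}
    (hτ : IsMarkovTrace d (algebraMap A B r) (algebraMap A B z) (fun s => algebraMap A B (x s)) τ)
    (n : ℕ) (w : ModularFramedBraidGroup d n) : τ n w ∈ (⊥ : Subalgebra A B) := by
  induction n with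
  | zero =>
    have hw : w ∈ strandGroup d 0 0 0 := by simp only [strandGroup_zero_self, Subgroup.mem_top]
    rw [strandGroup_self, Subgroup.mem_bot] at hw
    rw [hw, hτ.map_one_zero]
    exact one_mem _
  | succ n ih =>
    have hquad : IsQuadratic r (τ (n + 1)) := fun i hi v w => by
      simpa only [Algebra.smul_def, Algebra.algebraMap_self_apply] using
        hτ.isQuadratic (n + 1) i hi v w
    suffices h : Submodule.span A (τ (n + 1) '' strandCosets d (n + 1) 0 n) ≤
        Subalgebra.toSubmodule ⊥ from
      h (hquad.apply_mem_span_strandCosets (Nat.lt_succ_self n)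
        (strandGroup_zero_self (d := d) ▸ Subgroup.mem_top w))
    have hmem {v} (hv : v ∈ strandGroup d (n + 1) 0 n) : ∃ v', addStrand d n v' = v := by
      rw [← map_addStrand_strandGroup le_rfl] at hv
      exact hv.imp fun _ h => h.2
    rw [Submodule.span_le]
    rintro _ ⟨_, ⟨_, s, v, hv, rfl⟩ | ⟨i, hi, _, rfl, u, hu, v, hv, rfl⟩, rfl⟩
    · obtain ⟨v, rfl⟩ := hmem hv
      exact hτ.framing n v s ▸ (⊥ : Subalgebra A B).mul_mem (Subalgebra.algebraMap_mem _ _) (ih v)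
    · obtain ⟨u, rfl⟩ := hmem hu
      obtain ⟨v, rfl⟩ := hmem hv
      rw [hτ.map_mul_cycle, ← map_mul, hτ.markov]
      exact (⊥ : Subalgebra A B).mul_mem (Subalgebra.algebraMap_mem _ _) (ih (v * u))

theorem exists_of_algebraMap_injective [Algebra A B]
    (hinj : Function.Injective (algebraMap A B)) {τ : ∀ n, ModularFramedBraidGroup d n → B}
    (hτ : IsMarkovTrace d (algebraMap A B r) (algebraMap A B z)
      (fun s => algebraMap A B (x s)) τ) :
    ∃ τ', IsMarkovTrace d r z x τ' := by
  choose τ' hτ' using fun n w => Algebra.mem_bot.1 (hτ.apply_mem_bot n w)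
  obtain rfl : (fun n w => algebraMap A B (τ' n w)) = τ := funext fun n => funext (hτ' n)
  exact ⟨τ', of_map_injective hinj hτ⟩

end Values

section Multiplicativity

variable {A : Type*} [CommRing A] {r z : A} {x : ZMod d → A}
  {τ : ∀ n, ModularFramedBraidGroup d n → A}

lemma map_addStrand (hτ : IsMarkovTrace d r z x τ) (hx : x 0 = 1)
    (w : ModularFramedBraidGroup d n) : τ (n + 1) (addStrand d n w) = τ n w := by
  simpa only [zpow_zero, mul_one, Int.cast_zero, hx, one_mul] using hτ.framing n w 0

lemma map_mul_mframing_zpow (hτ : IsMarkovTrace d r z x τ) (hx : x 0 = 1) {l : ℕ} (hl : l < n)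
    {a : ModularFramedBraidGroup d n} (ha : a ∈ strandGroup d n 0 l) (s : ℤ) :
    τ n (a * mframing d ⟨l, hl⟩ ^ s) = x s * τ n a := by
  induction n with
  | zero => exact absurd hl (Nat.not_lt_zero l)
  | succ n ih =>
    rw [← map_addStrand_strandGroup (Nat.lt_succ_iff.1 hl)] at ha
    obtain ⟨b, hb, rfl⟩ := ha
    rw [hτ.map_addStrand hx]
    obtain hln | rfl := (Nat.lt_succ_iff.1 hl).lt_or_eq
    · rw [← ih hln hb, ← hτ.map_addStrand hx (b * _), map_mul, map_zpow, addStrand_mframing,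
        Fin.castSucc_mk]
    · exact hτ.framing l b s

lemma map_mul_msigma (hτ : IsMarkovTrace d r z x τ) (hx : x 0 = 1) {i : ℕ} (hi : i + 1 < n)
    {a : ModularFramedBraidGroup d n} (ha : a ∈ strandGroup d n 0 (i + 1)) :
    τ n (a * msigma d i hi) = z * τ n a := by
  induction n with
  | zero => exact absurd hi (Nat.not_lt_zero _)
  | succ n ih =>
    rw [← map_addStrand_strandGroup (Nat.lt_succ_iff.1 hi)] at ha
    obtain ⟨b, hb, rfl⟩ := ha
    rw [hτ.map_addStrand hx]
    obtain hin | rfl := (Nat.lt_succ_iff.1 hi).lt_or_eq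
    · rw [← ih hin hb, ← hτ.map_addStrand hx (b * _), map_mul, addStrand_msigma]
    · exact hτ.markov i b

lemma map_one (hτ : IsMarkovTrace d r z x τ) (hx : x 0 = 1) (n : ℕ) : τ n 1 = 1 := by
  induction n with
  | zero => exact hτ.map_one_zero
  | succ n ih => rw [← (addStrand d n).map_one, hτ.map_addStrand hx, ih]

theorem map_mul_of_mem_strandGroup (hτ : IsMarkovTrace d r z x τ) (hx : x 0 = 1) {k l : ℕ}
    (hkl : k ≤ l) (hln : l ≤ n) {a b : ModularFramedBraidGroup d n}
    (ha : a ∈ strandGroup d n 0 k) (hb : b ∈ strandGroup d n k l) :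
    τ n (a * b) = τ n a * τ n b := by
  induction l, hkl using Nat.le_induction generalizing b with
  | base =>
    rw [strandGroup_self, Subgroup.mem_bot] at hb
    rw [hb, mul_one, hτ.map_one hx, mul_one]
  | succ l hkl ih =>
    have ih {c} (hc : c ∈ strandGroup d n k l) : τ n (a * c) = τ n a * τ n c :=
      ih (Nat.le_of_succ_le hln) hc
    have hle : strandGroup d n k l ≤ strandGroup d n 0 l := strandGroup_mono (Nat.zero_le _) le_rfl
    have ha' : a ∈ strandGroup d n 0 l := strandGroup_mono le_rfl hkl ha
    have hquad : IsQuadratic (M := A) r fun c => τ n (a * c) := by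
      simpa only [mul_one] using (hτ.isQuadratic n).comp_mul_mul a 1
    refine hquad.eqOn_strandGroup ((hτ.isQuadratic n).const_smul (τ n a)) hln ?_ hb
    rintro _ (⟨_, s, c, hc, rfl⟩ | ⟨i, hi, _, rfl, u, hu, v, hv, rfl⟩)
    · simp only [Pi.smul_apply, smul_eq_mul]
      rw [← mul_assoc, hτ.map_mul_mframing_zpow hx _ (mul_mem ha' (hle hc)),
        hτ.map_mul_mframing_zpow hx _ (hle hc), ih hc, mul_left_comm]
    · simp only [Pi.smul_apply, smul_eq_mul]
      rw [← mul_assoc, ← mul_assoc, hτ.map_mul_cycle, hτ.map_mul_cycle u, ← mul_assoc,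
        hτ.map_mul_msigma hx hi (mul_mem (mul_mem (hle hv) ha') (hle hu)),
        hτ.map_mul_msigma hx hi (mul_mem (hle hv) (hle hu)), ← hτ.map_mul_cycle,
        mul_assoc a, ih (mul_mem hu hv), hτ.map_mul_comm n u v, mul_left_comm]

theorem map_list_prod_of_mem_strandGroup (hτ : IsMarkovTrace d r z x τ) (hx : x 0 = 1) {m : ℕ}
    {c : Fin (m + 1) → ℕ} (hc : Monotone c) (hcn : c (Fin.last m) ≤ n)
    {a : Fin m → ModularFramedBraidGroup d n}
    (ha : ∀ j, a j ∈ strandGroup d n (c j.castSucc) (c j.succ)) :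
    τ n (List.ofFn a).prod = ∏ j, τ n (a j) := by
  suffices h : (List.ofFn a).prod ∈ strandGroup d n 0 (c (Fin.last m)) ∧
      τ n (List.ofFn a).prod = ∏ j, τ n (a j) from h.2
  induction m with
  | zero => simp [one_mem, hτ.map_one hx]
  | succ m ih =>
    have hle : c (Fin.last m).castSucc ≤ c (Fin.last (m + 1)) := hc (Fin.le_last _)
    obtain ⟨hmem, hprod⟩ := ih (hc.comp Fin.strictMono_castSucc.monotone) (hle.trans hcn)
      fun j => ha j.castSucc
    simp only [List.ofFn_succ', List.concat_eq_append, List.prod_append, List.prod_singleton,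
      Fin.prod_univ_castSucc]
    refine ⟨mul_mem (strandGroup_mono le_rfl hle hmem)
      (strandGroup_mono (Nat.zero_le _) le_rfl (ha (Fin.last m))), ?_⟩
    rw [hτ.map_mul_of_mem_strandGroup hx hle hcn hmem (ha (Fin.last m)), hprod]

end Multiplicativity

end IsMarkovTrace

/-! ### R-matrix models -/

section Exchange

variable {X K : Type*} [CommRing K]

/-- Letters coloured by `X`, with `N χ` letters of colour `χ`. -/
abbrev Letter (N : X → ℕ) : Type _ := (χ : X) × Fin (N χ)

variable {N : X → ℕ}

lemma Letter.eq_iff {x y : Letter N} : x = y ↔ x.1 = y.1 ∧ (x.2 : ℕ) = y.2 := by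
  constructor
  · rintro rfl; exact ⟨rfl, rfl⟩
  · obtain ⟨χ, i⟩ := x
    obtain ⟨χ', j⟩ := y
    rintro ⟨h1, h2⟩
    dsimp only at h1 h2
    subst h1
    rw [Fin.ext h2]

variable [DecidableEq X]

/-- The coefficient of the identity in the R-matrix that acts on the pair of letters `x`, `y`. -/
def exch (u c : K) (x y : Letter N) : K :=
  if x = y then u - 1 else if x.1 = y.1 ∧ (y.2 : ℕ) < x.2 then c else 0

lemma exch_self (u c : K) (x : Letter N) : exch u c x x = u - 1 := if_pos rfl

lemma exch_of_ne (u c : K) {x y : Letter N} (h : x ≠ y) :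
    exch u c x y = if x.1 = y.1 ∧ (y.2 : ℕ) < x.2 then c else 0 := if_neg h

lemma exch_eq_zero_or_eq (u c : K) (x y : Letter N) : exch u c x y = 0 ∨ x.1 = y.1 := by
  rw [exch]
  split_ifs with h h'
  · exact Or.inr (h ▸ rfl)
  · exact Or.inr h'.1
  · exact Or.inl rfl

lemma exch_quad {u c : K} (hu : u * u = 1 + c * u) (p q : Letter N) (f₀ f₁ : K)
    (hpq : p = q → f₁ = f₀) :
    f₀ + exch u c q p * f₁ + exch u c p q * (f₁ + exch u c p q * f₀) =
      f₀ + c * ((if p.1 = q.1 then 1 else 0) * (f₁ + exch u c p q * f₀)) := by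
  by_cases h : p = q
  · subst h
    rw [hpq rfl, exch_self, if_pos rfl]
    linear_combination f₀ * hu
  · rw [exch_of_ne u c h, exch_of_ne u c (Ne.symm h)]
    rw [Letter.eq_iff, not_and_or] at h
    by_cases hc : p.1 = q.1
    · have h' : (p.2 : ℕ) ≠ q.2 := h.resolve_left (not_not.2 hc)
      rcases Nat.lt_or_gt_of_ne h' with h1 | h1
      · simp [hc, h1, not_lt.2 h1.le]
      · simp [hc, h1, not_lt.2 h1.le]
    · simp [hc, Ne.symm hc]

lemma exch_braid {u c : K} (hu : u * u = 1 + c * u) (p q r : Letter N) (f₀ f₁ f₂ : K)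
    (hpq : p = q → f₁ = f₀) (hqr : q = r → f₂ = f₀) :
    (exch u c p r * exch u c q p + exch u c p q * exch u c q r - exch u c q r * exch u c p r) * f₁ +
    (exch u c p q * exch u c p r - exch u c p r * exch u c r q - exch u c q r * exch u c p q) * f₂ +
    (exch u c p q ^ 2 * exch u c q r - exch u c q r ^ 2 * exch u c p q) * f₀ = 0 := by
  by_cases h1 : p = q
  · subst h1
    rw [hpq rfl, exch_self]
    by_cases h2 : p = r
    · subst h2
      rw [hqr rfl, exch_self]; ring
    · rw [exch_of_ne u c h2, exch_of_ne u c (Ne.symm h2)]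
      rw [Letter.eq_iff] at h2
      split_ifs <;> first | (exfalso; omega) | linear_combination c * f₀ * hu | ring
  · by_cases h2 : q = r
    · subst h2
      rw [hqr rfl, exch_self, exch_of_ne u c h1, exch_of_ne u c (Ne.symm h1)]
      rw [Letter.eq_iff] at h1
      split_ifs <;> first | (exfalso; omega) | linear_combination (-c * f₀) * hu | ring
    · by_cases h3 : p = r
      · subst h3
        rw [exch_self, exch_of_ne u c h1, exch_of_ne u c h2]
        rw [Letter.eq_iff] at h1 h2
        split_ifs <;> first | (exfalso; omega) | ring
      · rw [exch_of_ne u c h1, exch_of_ne u c h2, exch_of_ne u c h3,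
          exch_of_ne u c (Ne.symm h1), exch_of_ne u c (Ne.symm h2)]
        rw [Letter.eq_iff] at h1 h2 h3
        split_ifs <;> first | (exfalso; grind) | ring

end Exchange

section Words

variable {X : Type*} {N : X → ℕ} {n : ℕ}

/-- Words of length `n`. -/
abbrev Word (N : X → ℕ) (n : ℕ) : Type _ := Fin n → Letter N

lemma comp_strandSwap_left (i : ℕ) (hi : i + 1 < n) (w : Word N n) :
    (w ∘ strandSwap i hi) ⟨i, Nat.lt_of_succ_lt hi⟩ = w ⟨i + 1, hi⟩ := by
  rw [Function.comp_apply, strandSwap_left]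

lemma comp_strandSwap_right (i : ℕ) (hi : i + 1 < n) (w : Word N n) :
    (w ∘ strandSwap i hi) ⟨i + 1, hi⟩ = w ⟨i, Nat.lt_of_succ_lt hi⟩ := by
  rw [Function.comp_apply, strandSwap_right]

lemma comp_strandSwap_of_ne {i : ℕ} (hi : i + 1 < n) (w : Word N n) {j : Fin n}
    (h : (j : ℕ) ≠ i) (h' : (j : ℕ) ≠ i + 1) : (w ∘ strandSwap i hi) j = w j := by
  rw [Function.comp_apply, strandSwap_of_ne hi h h']

lemma comp_strandSwap_comp_strandSwap (i : ℕ) (hi : i + 1 < n) (w : Word N n) :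
    (w ∘ strandSwap i hi) ∘ strandSwap i hi = w :=
  funext fun j => congrArg w (Equiv.swap_apply_self _ _ j)

lemma comp_strandSwap_eq_self {i : ℕ} {hi : i + 1 < n} {w : Word N n}
    (h : w ⟨i, Nat.lt_of_succ_lt hi⟩ = w ⟨i + 1, hi⟩) : w ∘ strandSwap i hi = w :=
  funext (Equiv.apply_swap_eq_self h)

lemma comp_strandSwap_comm {i j : ℕ} (hi : i + 1 < n) (hj : j + 1 < n) (hij : i + 1 < j)
    (w : Word N n) : (w ∘ strandSwap i hi) ∘ strandSwap j hj =
      (w ∘ strandSwap j hj) ∘ strandSwap i hi := by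
  funext k
  simp only [Function.comp_apply, strandSwap, Equiv.swap_apply_def, Fin.ext_iff]
  congr 1
  grind

lemma comp_strandSwap_braid (i : ℕ) (hi : i + 1 < n) (hj : i + 1 + 1 < n) (w : Word N n) :
    ((w ∘ strandSwap i hi) ∘ strandSwap (i + 1) hj) ∘ strandSwap i hi =
      ((w ∘ strandSwap (i + 1) hj) ∘ strandSwap i hi) ∘ strandSwap (i + 1) hj := by
  funext k
  simp only [Function.comp_apply, strandSwap, Equiv.swap_apply_def, Fin.ext_iff]
  congr 1
  grind

end Words

section Operators

open Matrix

variable {X K : Type*} [DecidableEq X] [CommRing K] {N : X → ℕ} {n : ℕ}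

/-- The operators on words. -/
abbrev WordMatrix (N : X → ℕ) (K : Type*) (n : ℕ) : Type _ := Matrix (Word N n) (Word N n) K

/-- The R-matrix acting on the letters `i` and `i + 1`. -/
def braidMatrix (u c : K) (i : ℕ) (hi : i + 1 < n) : WordMatrix N K n := fun w v =>
  (if v = w ∘ strandSwap i hi then 1 else 0) +
    if v = w then exch u c (w ⟨i, Nat.lt_of_succ_lt hi⟩) (w ⟨i + 1, hi⟩) else 0

/-- The projection onto the words whose letters `i` and `i + 1` have the same colour: it
represents the idempotent `e_i`. -/
def sameColourMatrix (i : ℕ) (hi : i + 1 < n) : WordMatrix N K n :=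
  diagonal fun w => if (w ⟨i, Nat.lt_of_succ_lt hi⟩).1 = (w ⟨i + 1, hi⟩).1 then 1 else 0

/-- The diagonal operator that multiplies a word by `κ` of the colour of the letter `j`. -/
def colourMatrix (κ : X → K) (j : Fin n) : WordMatrix N K n := diagonal fun w => κ (w j).1

variable [Fintype X]

lemma braidMatrix_mul_apply (u c : K) (i : ℕ) (hi : i + 1 < n) (M : WordMatrix N K n)
    (w v : Word N n) : (braidMatrix u c i hi * M : WordMatrix N K n) w v =
      M (w ∘ strandSwap i hi) v +
        exch u c (w ⟨i, Nat.lt_of_succ_lt hi⟩) (w ⟨i + 1, hi⟩) * M w v := by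
  simp [Matrix.mul_apply, braidMatrix, add_mul, Finset.sum_add_distrib]

lemma commute_braidMatrix {u c : K} {i j : ℕ} (hi : i + 1 < n) (hj : j + 1 < n)
    (hij : i + 1 < j) :
    Commute (braidMatrix u c i hi : WordMatrix N K n) (braidMatrix u c j hj) := by
  rw [commute_iff_eq]
  suffices h : ∀ M : WordMatrix N K n, braidMatrix u c i hi * (braidMatrix u c j hj * M) =
      braidMatrix u c j hj * (braidMatrix u c i hi * M) by
    simpa only [mul_one] using h 1
  intro M
  ext w v
  simp only [braidMatrix_mul_apply]
  rw [comp_strandSwap_of_ne hi w (j := ⟨j, _⟩) (by simp; omega) (by simp; omega),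
    comp_strandSwap_of_ne hi w (j := ⟨j + 1, _⟩) (by simp; omega) (by simp; omega),
    comp_strandSwap_of_ne hj w (j := ⟨i, _⟩) (by simp; omega) (by simp; omega),
    comp_strandSwap_of_ne hj w (j := ⟨i + 1, _⟩) (by simp; omega) (by simp; omega),
    comp_strandSwap_comm hi hj hij]
  ring

lemma braidMatrix_braid {u c : K} (hu : u * u = 1 + c * u) (i : ℕ) (hi : i + 1 < n)
    (hj : i + 1 + 1 < n) :
    (braidMatrix u c i hi * braidMatrix u c (i + 1) hj * braidMatrix u c i hi :
      WordMatrix N K n) =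
      braidMatrix u c (i + 1) hj * braidMatrix u c i hi * braidMatrix u c (i + 1) hj := by
  suffices h : ∀ M : WordMatrix N K n,
      braidMatrix u c i hi * (braidMatrix u c (i + 1) hj * (braidMatrix u c i hi * M)) =
      braidMatrix u c (i + 1) hj * (braidMatrix u c i hi * (braidMatrix u c (i + 1) hj * M)) by
    simpa only [mul_assoc, mul_one] using h 1
  intro M
  ext w v
  have hright (w : Word N n) : (w ∘ strandSwap i hi) ⟨i + 1 + 1, hj⟩ = w ⟨i + 1 + 1, hj⟩ :=
    comp_strandSwap_of_ne _ _ (by simp; omega) (by simp)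
  have hleft (w : Word N n) : (w ∘ strandSwap (i + 1) hj) ⟨i, Nat.lt_of_succ_lt hi⟩ =
      w ⟨i, Nat.lt_of_succ_lt hi⟩ :=
    comp_strandSwap_of_ne _ _ (by simp) (by simp; omega)
  simp only [braidMatrix_mul_apply, comp_strandSwap_left, comp_strandSwap_right, hleft, hright,
    comp_strandSwap_comp_strandSwap, comp_strandSwap_braid]
  linear_combination exch_braid hu (w ⟨i, Nat.lt_of_succ_lt hi⟩) (w ⟨i + 1, hi⟩)
    (w ⟨i + 1 + 1, hj⟩) (M w v) (M (w ∘ strandSwap i hi) v) (M (w ∘ strandSwap (i + 1) hj) v)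
    (fun h => by rw [comp_strandSwap_eq_self h]) (fun h => by rw [comp_strandSwap_eq_self h])

lemma braidMatrix_sq {u c : K} (hu : u * u = 1 + c * u) (i : ℕ) (hi : i + 1 < n) :
    (braidMatrix u c i hi ^ 2 : WordMatrix N K n) =
      1 + c • (sameColourMatrix i hi * braidMatrix u c i hi) := by
  suffices h : ∀ M : WordMatrix N K n, braidMatrix u c i hi * (braidMatrix u c i hi * M) =
      M + c • (sameColourMatrix i hi * (braidMatrix u c i hi * M)) by
    simpa only [pow_two, mul_one] using h 1
  intro M
  ext w v
  simp only [Matrix.add_apply, Matrix.smul_apply, sameColourMatrix, diagonal_mul,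
    braidMatrix_mul_apply, comp_strandSwap_left, comp_strandSwap_right,
    comp_strandSwap_comp_strandSwap, smul_eq_mul]
  exact exch_quad hu _ _ _ _ fun h => by rw [comp_strandSwap_eq_self h]

lemma colourMatrix_mul_braidMatrix (κ : X → K) (u c : K) (i : ℕ) (hi : i + 1 < n) (j : Fin n) :
    (colourMatrix κ j * braidMatrix u c i hi : WordMatrix N K n) =
      braidMatrix u c i hi * colourMatrix κ (strandSwap i hi j) := by
  ext w v
  have hexch : κ (w j).1 * exch u c (w ⟨i, Nat.lt_of_succ_lt hi⟩) (w ⟨i + 1, hi⟩) =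
      exch u c (w ⟨i, Nat.lt_of_succ_lt hi⟩) (w ⟨i + 1, hi⟩) * κ (w (strandSwap i hi j)).1 := by
    rcases exch_eq_zero_or_eq u c (w ⟨i, Nat.lt_of_succ_lt hi⟩) (w ⟨i + 1, hi⟩) with h | h
    · rw [h, zero_mul, mul_zero]
    · rw [mul_comm, strandSwap,
        Equiv.apply_swap_eq_self (v := fun j => κ (w j).1) (congrArg κ h)]
  simp only [colourMatrix, diagonal_mul, mul_diagonal, braidMatrix, mul_add, add_mul, mul_ite,
    ite_mul, mul_one, one_mul, mul_zero, zero_mul]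
  congr 1
  · split_ifs with h
    · rw [h, Function.comp_apply, strandSwap, Equiv.swap_apply_self]
    · rfl
  · split_ifs with h
    · rw [h, hexch]
    · rfl

lemma colourMatrix_mul_colourMatrix (κ κ' : X → K) (j : Fin n) :
    (colourMatrix κ j * colourMatrix κ' j : WordMatrix N K n) =
      colourMatrix (fun χ => κ χ * κ' χ) j :=
  diagonal_mul_diagonal _ _

lemma commute_colourMatrix (κ κ' : X → K) (i j : Fin n) :
    Commute (colourMatrix κ i : WordMatrix N K n) (colourMatrix κ' j) :=
  commute_diagonal _ _

end Operators

section CharacterSums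

variable {d : ℕ} [NeZero d]

lemma sum_Icc_natCast {M : Type*} [AddCommMonoid M] (f : ZMod d → M) :
    ∑ s ∈ Finset.Icc 1 d, f s = ∑ s, f s := by
  obtain ⟨k, rfl⟩ := Nat.exists_eq_succ_of_ne_zero (NeZero.ne d)
  calc ∑ s ∈ Finset.Icc 1 (k + 1), f s = ∑ s ∈ Finset.range (k + 1), f (s + 1 : ℕ) := by
        rw [Finset.range_eq_Ico, Finset.sum_Ico_add' (fun s : ℕ => f s)]
        rfl
    _ = ∑ s : ZMod (k + 1), f (s + 1) := by
        rw [Finset.sum_range]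
        refine Finset.sum_congr rfl fun s _ => ?_
        rw [Nat.cast_add_one]
        exact congrArg (f <| · + 1) (Fin.cast_val_eq_self s)
    _ = ∑ s, f s := Equiv.sum_comp (Equiv.addRight 1) f

lemma sum_addChar_mul_addChar_neg {K : Type*} [CommRing K] [IsDomain K]
    (ψ ψ' : AddChar (ZMod d) K) [Decidable (ψ = ψ')] :
    ∑ s, ψ s * ψ' (-s) = if ψ = ψ' then (d : K) else 0 := by
  classical
  simpa only [sub_eq_zero, ZMod.card, AddChar.sub_apply] using AddChar.sum_eq_ite (ψ - ψ')

end CharacterSums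

section Model

open Matrix

variable {X K : Type*} [DecidableEq X] [Fintype X] [CommRing K] {N : X → ℕ} {d n : ℕ}

/-- The action of the powers of a framing generator: `t_j ^ s` multiplies a word by `κ χ s`,
where `χ` is the colour of the letter `j`. -/
def colourHom (κ : X → AddChar (ZMod d) K) (j : Fin n) :
    Multiplicative (ZMod d) →* WordMatrix N K n where
  toFun s := colourMatrix (fun χ => κ χ s.toAdd) j
  map_one' := by simp [colourMatrix]
  map_mul' s s' := by simp [colourMatrix_mul_colourMatrix, AddChar.map_add_eq_mul]

lemma sum_colourMatrix [NeZero d] [IsDomain K] {κ : X → AddChar (ZMod d) K}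
    (hκ : Function.Injective κ) (i : ℕ) (hi : i + 1 < n) :
    ∑ s, (colourMatrix (fun χ => κ χ s) ⟨i, Nat.lt_of_succ_lt hi⟩ *
      colourMatrix (fun χ => κ χ (-s)) ⟨i + 1, hi⟩ : WordMatrix N K n) =
      (d : K) • sameColourMatrix i hi := by
  classical
  simp only [colourMatrix, sameColourMatrix, diagonal_mul_diagonal, ← diagonal_smul]
  ext w v
  rw [Matrix.sum_apply]
  by_cases h : w = v
  · subst h
    simp only [diagonal_apply_eq, sum_addChar_mul_addChar_neg, hκ.eq_iff, Pi.smul_apply,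
      smul_eq_mul, mul_ite, mul_one, mul_zero]
  · simp only [diagonal_apply_ne _ h, Finset.sum_const_zero]

lemma units_mul_self (u : Kˣ) : (u * u : K) = 1 + (u - ↑u⁻¹) * u := by
  rw [sub_mul, u.inv_mul, add_sub_cancel]

lemma braidMatrix_sub_mul_braidMatrix {u c : K} (hu : u * u = 1 + c * u) (i : ℕ)
    (hi : i + 1 < n) :
    (braidMatrix u c i hi - c • sameColourMatrix i hi) * braidMatrix u c i hi =
      (1 : WordMatrix N K n) := by
  rw [Matrix.sub_mul, ← pow_two, braidMatrix_sq hu, Matrix.smul_mul, add_sub_cancel_right]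

variable (N) in
/-- The R-matrix as a unit, for `c = u - u⁻¹`. -/
def braidUnit (u : Kˣ) (i : ℕ) (hi : i + 1 < n) : (WordMatrix N K n)ˣ where
  val := braidMatrix (u : K) (u - ↑u⁻¹) i hi
  inv := braidMatrix (u : K) (u - ↑u⁻¹) i hi - (u - ↑u⁻¹ : K) • sameColourMatrix i hi
  val_inv := mul_eq_one_comm.1 (braidMatrix_sub_mul_braidMatrix (units_mul_self u) i hi)
  inv_val := braidMatrix_sub_mul_braidMatrix (units_mul_self u) i hi

variable (N) in
/-- The action of a framing generator as a unit. -/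
def colourUnit (κ : X → AddChar (ZMod d) K) (j : Fin n) : (WordMatrix N K n)ˣ :=
  (colourHom κ j).toHomUnits (.ofAdd 1)

lemma coe_colourUnit_zpow (κ : X → AddChar (ZMod d) K) (j : Fin n) (s : ℤ) :
    (↑(colourUnit N κ j ^ s) : WordMatrix N K n) = colourMatrix (fun χ => κ χ s) j := by
  rw [colourUnit, ← map_zpow, ← ofAdd_zsmul, zsmul_one]
  rfl

lemma colourUnit_pow_eq_one (κ : X → AddChar (ZMod d) K) (j : Fin n) :
    colourUnit N κ j ^ d = 1 := by
  rw [colourUnit, ← map_pow, ← ofAdd_nsmul, nsmul_one, ZMod.natCast_self, ofAdd_zero, map_one]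

lemma braidUnit_braid (u : Kˣ) (i : ℕ) (hi : i + 1 < n) (hj : i + 1 + 1 < n) :
    braidUnit N u i hi * braidUnit N u (i + 1) hj * braidUnit N u i hi =
      braidUnit N u (i + 1) hj * braidUnit N u i hi * braidUnit N u (i + 1) hj :=
  Units.ext (braidMatrix_braid (units_mul_self u) i hi hj)

lemma commute_braidUnit (u : Kˣ) {i j : ℕ} (hi : i + 1 < n) (hj : j + 1 < n) (hij : i + 1 < j) :
    Commute (braidUnit N u i hi) (braidUnit N u j hj) :=
  Units.ext (commute_braidMatrix hi hj hij)

lemma commute_colourUnit (κ : X → AddChar (ZMod d) K) (i j : Fin n) :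
    Commute (colourUnit N κ i) (colourUnit N κ j) :=
  Units.ext (commute_colourMatrix (fun χ => κ χ 1) (fun χ => κ χ 1) i j)

lemma colourUnit_mul_braidUnit (u : Kˣ) (κ : X → AddChar (ZMod d) K) (i : ℕ) (hi : i + 1 < n)
    (j : Fin n) : colourUnit N κ j * braidUnit N u i hi =
      braidUnit N u i hi * colourUnit N κ (strandSwap i hi j) :=
  Units.ext (colourMatrix_mul_braidMatrix (fun χ => κ χ 1) _ _ i hi j)

variable (N) in
/-- The generators of `F_{d,n}` in the model. -/
def modelGen (u : Kˣ) (κ : X → AddChar (ZMod d) K) : Gen n → (WordMatrix N K n)ˣ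
  | .sigma i hi => braidUnit N u i hi
  | .framing j => colourUnit N κ j

lemma lift_modelGen_eq_one (u : Kˣ) (κ : X → AddChar (ZMod d) K) {w : FreeGroup (Gen n)}
    (hw : ModularRel d n w) : FreeGroup.lift (modelGen N u κ) w = 1 := by
  rcases hw with ⟨w, ⟨i, hi, hj⟩ | ⟨i, j, hi, hj, hij⟩ | ⟨i, j⟩ | ⟨i, hi, j⟩⟩ | j
  · rw [map_mul, map_inv, mul_inv_eq_one]
    simpa only [map_mul, wordSigma, FreeGroup.lift_apply_of, modelGen] using
      braidUnit_braid u i hi hj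
  · rw [map_mul, map_inv, mul_inv_eq_one]
    simpa only [map_mul, wordSigma, FreeGroup.lift_apply_of, modelGen] using
      (commute_braidUnit u hi hj hij).eq
  · rw [map_mul, map_inv, mul_inv_eq_one]
    simpa only [map_mul, wordFraming, FreeGroup.lift_apply_of, modelGen] using
      (commute_colourUnit κ i j).eq
  · rw [map_mul, map_inv, mul_inv_eq_one]
    simpa only [map_mul, wordSigma, wordFraming, FreeGroup.lift_apply_of, modelGen] using
      colourUnit_mul_braidUnit u κ i hi j
  · simpa only [map_pow, wordFraming, FreeGroup.lift_apply_of, modelGen] using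
      colourUnit_pow_eq_one κ j

variable (N) in
/-- The representation of `F_{d,n}` on words. -/
def modelHom (u : Kˣ) (κ : X → AddChar (ZMod d) K) :
    ModularFramedBraidGroup d n →* (WordMatrix N K n)ˣ :=
  PresentedGroup.toGroup fun _ hw => lift_modelGen_eq_one u κ hw

variable {u : Kˣ} {κ : X → AddChar (ZMod d) K}

lemma modelHom_msigma (i : ℕ) (hi : i + 1 < n) :
    modelHom N u κ (msigma d i hi) = braidUnit N u i hi :=
  PresentedGroup.toGroup.of _

lemma modelHom_mframing (j : Fin n) :
    modelHom N u κ (mframing d j) = colourUnit N κ j :=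
  PresentedGroup.toGroup.of _

lemma modelHom_msigma_sq [NeZero d] [IsDomain K] (hκ : Function.Injective κ) {r : K}
    (hr : r * d = u - u⁻¹) (i : ℕ) (hi : i + 1 < n) :
    (↑(modelHom N u κ (msigma d i hi ^ 2)) : WordMatrix N K n) = 1 + r • ∑ s ∈ Finset.Icc 1 d,
      ↑(modelHom N u κ (mframing d ⟨i, Nat.lt_of_succ_lt hi⟩ ^ s *
        (mframing d ⟨i + 1, hi⟩ ^ s)⁻¹ * msigma d i hi)) := by
  have hterm (s : ℕ) : (↑(modelHom N u κ (mframing d ⟨i, Nat.lt_of_succ_lt hi⟩ ^ s *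
      (mframing d ⟨i + 1, hi⟩ ^ s)⁻¹ * msigma d i hi)) : WordMatrix N K n) =
      colourMatrix (fun χ => κ χ s) ⟨i, Nat.lt_of_succ_lt hi⟩ *
        colourMatrix (fun χ => κ χ (-s)) ⟨i + 1, hi⟩ * (braidUnit N u i hi).val := by
    rw [map_mul, map_mul, map_inv, map_pow, map_pow, modelHom_mframing, modelHom_mframing,
      modelHom_msigma, Units.val_mul, Units.val_mul, ← zpow_natCast, ← zpow_natCast,
      ← _root_.zpow_neg, coe_colourUnit_zpow, coe_colourUnit_zpow, Int.cast_neg, Int.cast_natCast]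
  rw [Finset.sum_congr rfl fun s _ => hterm s, ← Finset.sum_mul,
    sum_Icc_natCast (fun s => (colourMatrix (fun χ => κ χ s) ⟨i, Nat.lt_of_succ_lt hi⟩ *
      colourMatrix (fun χ => κ χ (-s)) ⟨i + 1, hi⟩ : WordMatrix N K n)), sum_colourMatrix hκ,
    smul_mul_assoc, smul_smul, hr, map_pow, modelHom_msigma]
  exact braidMatrix_sq (units_mul_self u) i hi

end Model

section AddLetter

open Matrix

variable {X K : Type*} {N : X → ℕ} {n : ℕ}

/-- The word `w` followed by the letter `x`. -/
def wordSnoc (w : Word N n) (x : Letter N) : Word N (n + 1) :=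
  Fin.snoc (α := fun _ => Letter N) w x

@[simp] lemma wordSnoc_castSucc (w : Word N n) (x : Letter N) (j : Fin n) :
    wordSnoc w x j.castSucc = w j := Fin.snoc_castSucc (α := fun _ => Letter N) x w j

@[simp] lemma wordSnoc_last (w : Word N n) (x : Letter N) : wordSnoc w x (Fin.last n) = x :=
  Fin.snoc_last (α := fun _ => Letter N) x w

lemma init_wordSnoc (w : Word N n) (x : Letter N) : Fin.init (wordSnoc w x) = w :=
  Fin.init_snoc (α := fun _ => Letter N) x w

lemma wordSnoc_inj {w w' : Word N n} {x x' : Letter N} :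
    wordSnoc w x = wordSnoc w' x' ↔ w = w' ∧ x = x' :=
  Fin.snoc_inj (α := fun _ => Letter N)

lemma exists_wordSnoc (w : Word N (n + 1)) : ∃ v x, w = wordSnoc v x :=
  ⟨Fin.init w, w (Fin.last n), (Fin.snoc_init_self (α := fun _ => Letter N) w).symm⟩

lemma wordSnoc_comp_strandSwap (w : Word N n) (x : Letter N) (i : ℕ) (hi : i + 1 < n) :
    wordSnoc w x ∘ strandSwap (n := n + 1) i (Nat.lt_succ_of_lt hi) =
      wordSnoc (w ∘ strandSwap i hi) x := by
  funext j
  induction j using Fin.lastCases with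
  | last =>
    rw [comp_strandSwap_of_ne _ _ (by simp; omega) (by simp; omega), wordSnoc_last, wordSnoc_last]
  | cast j =>
    rw [Function.comp_apply, ← strandSwap_castSucc, wordSnoc_castSucc, wordSnoc_castSucc]
    rfl

variable [Fintype X]

lemma sum_word_succ {M : Type*} [AddCommMonoid M] (f : Word N (n + 1) → M) :
    ∑ w, f w = ∑ w : Word N n, ∑ x : Letter N, f (wordSnoc w x) := by
  rw [Finset.sum_comm, ← Fintype.sum_prod_type']
  exact (Fintype.sum_equiv (Fin.snocEquiv fun _ => Letter N) _ _ fun _ => rfl).symm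

variable [DecidableEq X] [CommRing K]

/-- The action on the first `n` letters of a word of length `n + 1`. -/
def inclMatrix : WordMatrix N K n →* WordMatrix N K (n + 1) where
  toFun M := Matrix.of fun w v => if w (Fin.last n) = v (Fin.last n) then
    M (Fin.init w) (Fin.init v) else 0
  map_one' := by
    ext w v
    obtain ⟨w, x, rfl⟩ := exists_wordSnoc w
    obtain ⟨v, y, rfl⟩ := exists_wordSnoc v
    simp only [of_apply, wordSnoc_last, init_wordSnoc, one_apply, wordSnoc_inj]
    split_ifs <;> simp_all
  map_mul' M M' := by
    ext w v
    obtain ⟨w, x, rfl⟩ := exists_wordSnoc w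
    obtain ⟨v, y, rfl⟩ := exists_wordSnoc v
    simp only [of_apply, Matrix.mul_apply, sum_word_succ, wordSnoc_last, init_wordSnoc]
    by_cases h : x = y <;> simp [h]

lemma inclMatrix_apply (M : WordMatrix N K n) (w v : Word N n) (x y : Letter N) :
    inclMatrix M (wordSnoc w x) (wordSnoc v y) = if x = y then M w v else 0 := by
  simp only [inclMatrix, MonoidHom.coe_mk, OneHom.coe_mk, of_apply, wordSnoc_last, init_wordSnoc]

lemma inclMatrix_braidMatrix (u c : K) (i : ℕ) (hi : i + 1 < n) :
    inclMatrix (braidMatrix u c i hi : WordMatrix N K n) =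
      braidMatrix (n := n + 1) u c i (Nat.lt_succ_of_lt hi) := by
  ext w v
  obtain ⟨w, x, rfl⟩ := exists_wordSnoc w
  obtain ⟨v, y, rfl⟩ := exists_wordSnoc v
  have hleft : wordSnoc w x ⟨i, by omega⟩ = w ⟨i, by omega⟩ :=
    wordSnoc_castSucc w x ⟨i, by omega⟩
  have hright : wordSnoc w x ⟨i + 1, by omega⟩ = w ⟨i + 1, hi⟩ :=
    wordSnoc_castSucc w x ⟨i + 1, hi⟩
  simp only [inclMatrix_apply, braidMatrix, hleft, hright]
  rw [wordSnoc_comp_strandSwap w x i hi]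
  simp only [wordSnoc_inj]
  by_cases h : x = y
  · simp [h]
  · simp [h, Ne.symm h]

lemma inclMatrix_colourMatrix (κ : X → K) (j : Fin n) :
    inclMatrix (colourMatrix κ j : WordMatrix N K n) = colourMatrix κ j.castSucc := by
  ext w v
  obtain ⟨w, x, rfl⟩ := exists_wordSnoc w
  obtain ⟨v, y, rfl⟩ := exists_wordSnoc v
  rw [inclMatrix_apply]
  simp only [colourMatrix, diagonal_apply, wordSnoc_inj, wordSnoc_castSucc]
  split_ifs <;> simp_all

lemma inclMatrix_modelHom {d : ℕ} (u : Kˣ) (κ : X → AddChar (ZMod d) K)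
    (w : ModularFramedBraidGroup d n) :
    inclMatrix (modelHom N u κ w : WordMatrix N K n) = modelHom N u κ (addStrand d n w) := by
  suffices h : (Units.map inclMatrix).comp (modelHom N u κ) =
      (modelHom N u κ).comp (addStrand d n) from
    congrArg (Units.val (α := WordMatrix N K (n + 1))) (DFunLike.congr_fun h w)
  refine PresentedGroup.ext fun a => Units.ext ?_
  cases a with
  | sigma i hi =>
    change inclMatrix (modelHom N u κ (msigma d i hi) : WordMatrix N K n) =
      modelHom N u κ (addStrand d n (msigma d i hi))
    rw [addStrand_msigma, modelHom_msigma, modelHom_msigma]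
    exact inclMatrix_braidMatrix _ _ i hi
  | framing j =>
    change inclMatrix (modelHom N u κ (mframing d j) : WordMatrix N K n) =
      modelHom N u κ (addStrand d n (mframing d j))
    rw [addStrand_mframing, modelHom_mframing, modelHom_mframing]
    exact inclMatrix_colourMatrix (fun χ => κ χ 1) j

end AddLetter

section WeightedTrace

open Matrix

variable {X K : Type*} [CommRing K] {N : X → ℕ} {n : ℕ}

/-- The weight of a word: the product of the weights of its letters. -/
def wordWeight (D : Letter N → K) (w : Word N n) : K := ∏ j, D (w j)

lemma wordWeight_snoc (D : Letter N → K) (w : Word N n) (x : Letter N) :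
    wordWeight D (wordSnoc w x) = wordWeight D w * D x := by
  simp [wordWeight, Fin.prod_univ_castSucc]

lemma wordWeight_comp_strandSwap (D : Letter N → K) (w : Word N n) (i : ℕ) (hi : i + 1 < n) :
    wordWeight D (w ∘ strandSwap i hi) = wordWeight D w :=
  Equiv.prod_comp (strandSwap i hi) fun j => D (w j)

variable [DecidableEq X] [Fintype X]

variable (n) in
/-- The diagonal matrix of the weights of the words. -/
def weightMatrix (D : Letter N → K) : WordMatrix N K n := diagonal (wordWeight D)

lemma commute_braidMatrix_weightMatrix (D : Letter N → K) (u c : K) (i : ℕ) (hi : i + 1 < n) :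
    Commute (braidMatrix u c i hi) (weightMatrix n D) := by
  ext w v
  rw [weightMatrix, mul_diagonal, diagonal_mul, braidMatrix]
  simp only [add_mul, mul_add, ite_mul, mul_ite, one_mul, mul_one, zero_mul, mul_zero]
  congr 1
  · split_ifs with h
    · rw [h, wordWeight_comp_strandSwap]
    · rfl
  · split_ifs with h
    · rw [h, mul_comm]
    · rfl

lemma commute_modelHom_weightMatrix {d : ℕ} (u : Kˣ) (κ : X → AddChar (ZMod d) K)
    (D : Letter N → K) (w : ModularFramedBraidGroup d n) :
    Commute (modelHom N u κ w : WordMatrix N K n) (weightMatrix n D) := by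
  have hw : w ∈ Subgroup.closure (Set.range PresentedGroup.of) := by
    rw [PresentedGroup.closure_range_of]
    exact Subgroup.mem_top w
  induction hw using Subgroup.closure_induction with
  | mem w hw =>
    obtain ⟨a, rfl⟩ := hw
    cases a with
    | sigma i hi =>
      change Commute (modelHom N u κ (msigma d i hi) : WordMatrix N K n) _
      rw [modelHom_msigma]
      exact commute_braidMatrix_weightMatrix D _ _ i hi
    | framing j =>
      change Commute (modelHom N u κ (mframing d j) : WordMatrix N K n) _
      rw [modelHom_mframing]
      exact commute_diagonal _ _
  | one =>
    rw [map_one]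
    exact Commute.one_left _
  | mul v w _ _ hv hw =>
    rw [map_mul]
    exact hv.mul_left hw
  | inv w _ hw =>
    rw [map_inv]
    exact hw.units_inv_left

/-- The weighted trace of the action of a framed braid on words. -/
def modelTrace {d : ℕ} (u : Kˣ) (κ : X → AddChar (ZMod d) K) (D : Letter N → K) (n : ℕ)
    (w : ModularFramedBraidGroup d n) : K :=
  trace ((modelHom N u κ w).val * weightMatrix n D)

lemma trace_mul_weightMatrix (D : Letter N → K) (M : WordMatrix N K n) :
    trace (M * weightMatrix n D) = ∑ w, M w w * wordWeight D w := by
  simp only [trace, diag_apply, weightMatrix, mul_diagonal]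

lemma modelTrace_mul_comm {d : ℕ} (u : Kˣ) (κ : X → AddChar (ZMod d) K) (D : Letter N → K)
    (v w : ModularFramedBraidGroup d n) :
    modelTrace u κ D n (v * w) = modelTrace u κ D n (w * v) := by
  simp only [modelTrace, map_mul, Units.val_mul]
  rw [mul_assoc, (commute_modelHom_weightMatrix u κ D w).eq, ← mul_assoc, trace_mul_comm,
    mul_assoc]

lemma isQuadratic_modelTrace {d : ℕ} [NeZero d] [IsDomain K] {u : Kˣ}
    {κ : X → AddChar (ZMod d) K} (hκ : Function.Injective κ) {r : K} (hr : r * d = u - u⁻¹)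
    (D : Letter N → K) : IsQuadratic r (modelTrace u κ D n) := by
  intro i hi v w
  simp only [modelTrace]
  rw [map_mul, map_mul, Units.val_mul, Units.val_mul, modelHom_msigma_sq hκ hr, mul_add,
    mul_one, add_mul, add_mul, trace_add, ← Units.val_mul, ← map_mul, mul_smul_comm,
    smul_mul_assoc, smul_mul_assoc, trace_smul, Finset.mul_sum, Finset.sum_mul, Finset.sum_mul,
    trace_sum]
  simp only [← Units.val_mul, ← map_mul]

lemma trace_inclMatrix_mul_colourMatrix (D : Letter N → K) (κ : X → K) (M : WordMatrix N K n) :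
    trace (inclMatrix M * colourMatrix κ (Fin.last n) * weightMatrix (n + 1) D) =
      (∑ x, κ x.1 * D x) * trace (M * weightMatrix n D) := by
  rw [trace_mul_weightMatrix, trace_mul_weightMatrix, sum_word_succ, Finset.mul_sum]
  refine Finset.sum_congr rfl fun w _ => ?_
  rw [Finset.sum_mul]
  refine Finset.sum_congr rfl fun x _ => ?_
  rw [colourMatrix, mul_diagonal, inclMatrix_apply, if_pos rfl, wordWeight_snoc, wordSnoc_last]
  ring

lemma inclMatrix_comp_strandSwap_apply (M : WordMatrix N K (n + 1)) (w : Word N (n + 1))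
    (x : Letter N) :
    inclMatrix M (wordSnoc w x ∘ strandSwap n (Nat.lt_succ_self (n + 1))) (wordSnoc w x) =
      if x = w (Fin.last n) then M w w else 0 := by
  have hleft : wordSnoc w x ⟨n, by omega⟩ = w (Fin.last n) := wordSnoc_castSucc w x (Fin.last n)
  have hright : wordSnoc w x ⟨n + 1, by omega⟩ = x := wordSnoc_last w x
  split_ifs with h
  · rw [comp_strandSwap_eq_self (by rw [hleft, hright, h]), inclMatrix_apply, if_pos rfl]
  · obtain ⟨v, y, e⟩ := exists_wordSnoc (wordSnoc w x ∘ strandSwap n (Nat.lt_succ_self (n + 1)))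
    have hy : y = w (Fin.last n) := by
      rw [← wordSnoc_last v y, ← e]
      exact (comp_strandSwap_right _ _ _).trans hleft
    rw [e, inclMatrix_apply, if_neg fun h' => h (h'.symm.trans hy)]

lemma trace_braidMatrix_mul_inclMatrix {D : Letter N → K} {u c z : K}
    (hD : ∀ y : Letter N, ∑ x, ((if x = y then 1 else 0) + exch u c y x) * D x = z)
    (M : WordMatrix N K (n + 1)) :
    trace (braidMatrix u c n (Nat.lt_succ_self (n + 1)) * inclMatrix M *
      weightMatrix (n + 2) D) = z * trace (M * weightMatrix (n + 1) D) := by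
  rw [trace_mul_weightMatrix, trace_mul_weightMatrix, sum_word_succ, Finset.mul_sum]
  refine Finset.sum_congr rfl fun w _ => ?_
  rw [← hD (w (Fin.last n)), Finset.sum_mul]
  refine Finset.sum_congr rfl fun x _ => ?_
  have hleft : wordSnoc w x ⟨n, by omega⟩ = w (Fin.last n) := wordSnoc_castSucc w x (Fin.last n)
  have hright : wordSnoc w x ⟨n + 1, by omega⟩ = x := wordSnoc_last w x
  rw [braidMatrix_mul_apply, hleft, hright, inclMatrix_comp_strandSwap_apply, inclMatrix_apply,
    if_pos rfl, wordWeight_snoc]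
  split_ifs <;> ring

lemma isMarkovTrace_modelTrace_of_sum_exch {d : ℕ} [NeZero d] [IsDomain K] {u : Kˣ}
    {κ : X → AddChar (ZMod d) K} (hκ : Function.Injective κ) {r : K} (hr : r * d = u - u⁻¹)
    {D : Letter N → K} {z : K}
    (hD : ∀ y : Letter N, ∑ x, ((if x = y then 1 else 0) + exch (u : K) (u - ↑u⁻¹) y x) * D x = z) :
    IsMarkovTrace d r z (fun s => ∑ x : Letter N, κ x.1 s * D x) (modelTrace u κ D) where
  isQuadratic _ := isQuadratic_modelTrace hκ hr D
  map_mul_comm _ := modelTrace_mul_comm u κ D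
  map_one_zero := by
    rw [modelTrace, trace_mul_weightMatrix, map_one]
    simp [wordWeight]
  markov n w := by
    rw [modelTrace_mul_comm, modelTrace, map_mul, Units.val_mul, modelHom_msigma,
      ← inclMatrix_modelHom]
    exact trace_braidMatrix_mul_inclMatrix hD _
  framing n w s := by
    rw [modelTrace, map_mul, Units.val_mul, map_zpow, modelHom_mframing, coe_colourUnit_zpow,
      ← inclMatrix_modelHom, trace_inclMatrix_mul_colourMatrix, modelTrace]

end WeightedTrace

section LetterWeight

variable {X K : Type*} [CommRing K] {N : X → ℕ}

/-- The weight `z v^{1+2i}` of the `i`-th letter of a colour, where `v = u⁻¹`: the partial trace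
of the R-matrix over its second letter is then the scalar `z`. -/
def letterWeight (v z : K) (x : Letter N) : K := z * v ^ (1 + 2 * (x.2 : ℕ))

lemma sum_range_letterWeight {u v : K} (h : u * v = 1) (i : ℕ) :
    (u - v) * ∑ k ∈ Finset.range i, v ^ (1 + 2 * k) = 1 - v ^ (2 * i) := by
  induction i with
  | zero => simp
  | succ i ih =>
    rw [Finset.sum_range_succ, mul_add, ih, show 2 * (i + 1) = 2 * i + 2 by ring]
    linear_combination v ^ (2 * i) * h

variable [DecidableEq X]

lemma exch_add_mul_letterWeight (u v z : K) (x y : Letter N) :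
    ((if x = y then 1 else 0) + exch u (u - v) y x) * letterWeight v z x =
      (if x = y then u * letterWeight v z x else 0) +
        if y.1 = x.1 ∧ (x.2 : ℕ) < y.2 then (u - v) * letterWeight v z x else 0 := by
  by_cases hx : x = y
  · subst hx
    simp [exch_self]
  · rw [exch_of_ne _ _ (Ne.symm hx)]
    simp [hx]

variable [Fintype X]

lemma sum_exch_letterWeight {u v : K} (h : u * v = 1) (z : K) (y : Letter N) :
    ∑ x, ((if x = y then 1 else 0) + exch u (u - v) y x) * letterWeight v z x = z := by
  obtain ⟨χ, i⟩ := y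
  have hbelow : ∑ j : Fin (N χ), (if (j : ℕ) < i then
      (u - v) * letterWeight v z (⟨χ, j⟩ : Letter N) else 0) =
      (u - v) * (z * ∑ k ∈ Finset.range i, v ^ (1 + 2 * k)) := by
    simp only [letterWeight]
    rw [Finset.mul_sum, Finset.mul_sum,
      Fin.sum_univ_eq_sum_range (fun j => if j < (i : ℕ) then (u - v) * (z * v ^ (1 + 2 * j))
        else 0) (N χ), ← Finset.sum_filter]
    refine Finset.sum_congr ?_ fun _ _ => rfl
    ext k
    have := i.2
    simp only [Finset.mem_filter, Finset.mem_range]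
    omega
  simp only [exch_add_mul_letterWeight]
  rw [Finset.sum_add_distrib, Finset.sum_ite_eq', if_pos (Finset.mem_univ _), Fintype.sum_sigma,
    Finset.sum_eq_single χ]
  · simp only [true_and]
    rw [hbelow, letterWeight]
    linear_combination z * v ^ (2 * (i : ℕ)) * h + z * sum_range_letterWeight h (i : ℕ)
  · intro χ' _ hne
    simp [Ne.symm hne]
  · simp

theorem isMarkovTrace_modelTrace {d : ℕ} [NeZero d] [IsDomain K] {u : Kˣ}
    {κ : X → AddChar (ZMod d) K} (hκ : Function.Injective κ) {r : K} (hr : r * d = u - u⁻¹)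
    (N : X → ℕ) (z : K) :
    IsMarkovTrace d r z (fun s => ∑ χ, κ χ s * ∑ k ∈ Finset.range (N χ), z * ↑u⁻¹ ^ (1 + 2 * k))
      (modelTrace u κ (letterWeight (N := N) ↑u⁻¹ z)) := by
  convert isMarkovTrace_modelTrace_of_sum_exch hκ hr (sum_exch_letterWeight u.mul_inv z)
    using 2 with s
  rw [Fintype.sum_sigma]
  refine Finset.sum_congr rfl fun χ _ => ?_
  rw [← Fin.sum_univ_eq_sum_range (fun k => z * (↑u⁻¹ : K) ^ (1 + 2 * k)), Finset.mul_sum]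
  rfl

end LetterWeight

/-! ### Existence of Markov traces -/

section Density

open MvPolynomial

lemma eq_zero_of_eval_map_eval {R σ τ : Type*} [CommRing R] [IsDomain R]
    {p : MvPolynomial τ (MvPolynomial σ R)} {S : σ → Set R} (hS : ∀ i, (S i).Infinite)
    (hp : ∀ a : σ → R, (∀ i, a i ∈ S i) → ∃ Y : τ → Set R, (∀ j, (Y j).Infinite) ∧
      ∀ b : τ → R, (∀ j, b j ∈ Y j) → eval b (map (eval a) p) = 0) : p = 0 := by
  ext e : 1
  refine funext_set S hS fun a ha => ?_
  obtain ⟨Y, hY, hzero⟩ := hp a fun i => ha i (Set.mem_univ i)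
  have hmap : map (eval a) p = 0 := funext_set Y hY fun b hb => by
    rw [map_zero, hzero b fun j => hb j (Set.mem_univ j)]
  rw [coeff_zero, map_zero, ← coeff_map, hmap, coeff_zero]

end Density

section GenericParameters

open MvPolynomial

/-- The ring `ℂ[r, z][y_χ]`, where `r` is the parameter of the quadratic relation and the `y_χ`
are the weights of the colours. -/
abbrev ParamRing (X : Type*) : Type _ := MvPolynomial X (MvPolynomial (Fin 2) ℂ)

/-- The parameter `u = k + 2` of an R-matrix. -/
def uParam (k : ℕ) : ℂˣ := Units.mk0 (k + 2) (by exact_mod_cast (k + 1).succ_ne_zero)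

lemma coe_uParam (k : ℕ) : (uParam k : ℂ) = (k + 2 : ℕ) := by
  rw [uParam, Units.val_mk0, Nat.cast_add, Nat.cast_ofNat]

lemma coe_inv_uParam (k : ℕ) : (↑(uParam k)⁻¹ : ℂ) = ((k + 2 : ℕ) : ℂ)⁻¹ := by
  rw [Units.val_inv_eq_inv_val, coe_uParam]

/-- The parameter `r = (u - u⁻¹) / d` of the quadratic relation for `u = k + 2`. -/
def rParam (d k : ℕ) : ℂ := (uParam k - ↑(uParam k)⁻¹) / d

/-- The weight of a colour with `N` letters for `u = k + 2` and `z = l + 1`. -/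
def colourWeight (k l N : ℕ) : ℂ :=
  ∑ i ∈ Finset.range N, (l + 1 : ℂ) * ↑(uParam k)⁻¹ ^ (1 + 2 * i)

lemma rParam_injective (d : ℕ) [NeZero d] : Function.Injective (rParam d) := by
  intro k k' h
  have hd : (d : ℂ) ≠ 0 := NeZero.ne _
  rw [rParam, rParam, div_left_inj' hd, coe_inv_uParam, coe_inv_uParam, coe_uParam, coe_uParam]
    at h
  have hk : ((k + 2 : ℕ) : ℂ) ≠ 0 := Nat.cast_ne_zero.2 (by omega)
  have hk' : ((k' + 2 : ℕ) : ℂ) ≠ 0 := Nat.cast_ne_zero.2 (by omega)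
  field_simp at h
  have hfactor : ((k : ℂ) - k') * (((k + 2) * (k' + 2) + 1 : ℕ) : ℂ) = 0 := by
    push_cast at h ⊢
    linear_combination h
  rcases mul_eq_zero.1 hfactor with hsub | hpos
  · exact_mod_cast sub_eq_zero.1 hsub
  · exact absurd (Nat.cast_eq_zero.1 hpos) (Nat.succ_ne_zero _)

lemma colourWeight_injective (k l : ℕ) : Function.Injective (colourWeight k l) := by
  intro N M h
  have hsum (N : ℕ) : (uParam k - ↑(uParam k)⁻¹ : ℂ) * colourWeight k l N =
      (l + 1) * (1 - ↑(uParam k)⁻¹ ^ (2 * N)) := by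
    rw [colourWeight, ← Finset.mul_sum, ← sum_range_letterWeight (uParam k).mul_inv N]
    ring
  have hpow := mul_left_cancel₀ (Nat.cast_add_one_ne_zero l)
    ((hsum N).symm.trans ((congrArg _ h).trans (hsum M)))
  rw [sub_right_inj, coe_inv_uParam, inv_pow, inv_pow, inv_inj] at hpow
  have := Nat.pow_right_injective (Nat.le_add_left 2 k)
    (show (k + 2) ^ (2 * N) = (k + 2) ^ (2 * M) by exact_mod_cast hpow)
  omega

variable {X : Type*}

/-- The values of the generic parameters in the model with `u = k + 2`, `z = l + 1` and `N χ`
letters of colour `χ`. -/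
def paramEval (d k l : ℕ) (N : X → ℕ) : ParamRing X →+* ℂ :=
  (eval fun χ => colourWeight k l (N χ)).comp (map (eval ![rParam d k, l + 1]))

lemma eq_zero_of_paramEval {d : ℕ} [NeZero d] {p : ParamRing X}
    (hp : ∀ k l N, paramEval d k l N p = 0) : p = 0 := by
  refine eq_zero_of_eval_map_eval
    (S := ![Set.range (rParam d), Set.range fun l : ℕ => (l + 1 : ℂ)]) ?_ fun a ha => ?_
  · rw [Fin.forall_fin_two]
    exact ⟨Set.infinite_range_of_injective (rParam_injective d),
      Set.infinite_range_of_injective ((add_left_injective 1).comp Nat.cast_injective)⟩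
  obtain ⟨⟨k, hk⟩, l, hl⟩ := Fin.forall_fin_two.1 ha
  have hpoint : a = ![rParam d k, l + 1] := by
    rw [← List.ofFn_inj]
    simp_all
  refine ⟨fun _ => Set.range (colourWeight k l),
    fun _ => Set.infinite_range_of_injective (colourWeight_injective k l), fun b hb => ?_⟩
  choose N hN using hb
  rw [hpoint, ← funext hN]
  exact hp k l N

end GenericParameters

section Existence

open MvPolynomial

variable {d : ℕ} [NeZero d]

theorem exists_isMarkovTrace_paramRing :
    ∃ τ, IsMarkovTrace d (C (X 0) : ParamRing (AddChar (ZMod d) ℂ)) (C (X 1))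
      (fun s => ∑ χ : AddChar (ZMod d) ℂ, C (C (χ s)) * X χ) τ := by
  classical
  let φ : ParamRing (AddChar (ZMod d) ℂ) →+* (ℕ × ℕ × (AddChar (ZMod d) ℂ → ℕ) → ℂ) :=
    RingHom.pi fun θ => paramEval d θ.1 θ.2.1 θ.2.2
  have hφ : Function.Injective φ := (injective_iff_map_eq_zero φ).2 fun p hp =>
    eq_zero_of_paramEval fun k l N => congrFun hp (k, l, N)
  have hmodel (θ : ℕ × ℕ × (AddChar (ZMod d) ℂ → ℕ)) :=
    isMarkovTrace_modelTrace (u := uParam θ.1) (κ := id) Function.injective_id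
      (div_mul_cancel₀ _ (NeZero.ne (d : ℂ))) θ.2.2 (θ.2.1 + 1)
  let := φ.toAlgebra
  refine IsMarkovTrace.exists_of_algebraMap_injective (τ := fun n w θ => modelTrace
    (uParam θ.1) id (letterWeight (N := θ.2.2) ↑(uParam θ.1)⁻¹ (θ.2.1 + 1)) n w) hφ
    (IsMarkovTrace.pi fun θ => ?_)
  convert hmodel θ using 1
  · simp [RingHom.algebraMap_toAlgebra, φ, paramEval, rParam]
  · simp [RingHom.algebraMap_toAlgebra, φ, paramEval]
  · simp [RingHom.algebraMap_toAlgebra, φ, paramEval, colourWeight]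

lemma sum_addChar_mul_sum {A : Type*} [CommRing A] [Algebra ℂ A] (x : ZMod d → A) (s : ZMod d) :
    ∑ χ : AddChar (ZMod d) ℂ, χ s • ((d : ℂ)⁻¹ • ∑ s', χ (-s') • x s') = x s := by
  calc ∑ χ : AddChar (ZMod d) ℂ, χ s • ((d : ℂ)⁻¹ • ∑ s', χ (-s') • x s')
      = ∑ s', ((d : ℂ)⁻¹ * ∑ χ : AddChar (ZMod d) ℂ, χ (s - s')) • x s' := by
        simp only [Finset.smul_sum, Finset.mul_sum, Finset.sum_smul, smul_smul, sub_eq_add_neg,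
          AddChar.map_add_eq_mul]
        rw [Finset.sum_comm]
        simp only [mul_left_comm]
    _ = x s := by
        simp [AddChar.sum_apply_eq_ite, sub_eq_zero, ZMod.card]

theorem exists_isMarkovTrace {A : Type*} [CommRing A] [Algebra ℂ A] (r z : A) (x : ZMod d → A) :
    ∃ τ, IsMarkovTrace d r z x τ := by
  obtain ⟨τ, hτ⟩ := exists_isMarkovTrace_paramRing (d := d)
  let ψ : ParamRing (AddChar (ZMod d) ℂ) →+* A :=
    eval₂Hom (aeval ![r, z] : MvPolynomial (Fin 2) ℂ →ₐ[ℂ] A).toRingHom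
      fun χ => (d : ℂ)⁻¹ • ∑ s, χ (-s) • x s
  refine ⟨fun n w => ψ (τ n w), ?_⟩
  convert hτ.map ψ using 1
  · simp [ψ]
  · simp [ψ]
  · funext s
    rw [← sum_addChar_mul_sum x s]
    simp [ψ, Algebra.smul_def]

end Existence

/-! ### Functions on framed braids and functionals on Yokonuma–Hecke algebras -/

section TraceCongruence

variable {k B P : Type*} [CommRing k] [Ring B] [Algebra k B] [AddCommGroup P] [Module k P]

/-- The largest ring congruence whose classes a linear map `f` does not separate. -/
def kerCon (f : B →ₗ[k] P) : RingCon B where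
  r x y := ∀ a b, f (a * x * b) = f (a * y * b)
  iseqv := ⟨fun _ _ _ => rfl, fun h a b => (h a b).symm, fun h h' a b => (h a b).trans (h' a b)⟩
  add' h h' a b := by simp only [mul_add, add_mul, map_add, h a b, h' a b]
  mul' {w x y z} h h' a b := by
    have hw := h a (y * b)
    have hy := h' (a * x) b
    simp only [← mul_assoc] at hw hy ⊢
    exact hw.trans hy

lemma exists_linearMap_ringQuot {r : B → B → Prop} (f : B →ₗ[k] P)
    (hf : ∀ x y, r x y → ∀ a b, f (a * x * b) = f (a * y * b)) :
    ∃ T : RingQuot r →ₗ[k] P, ∀ a, T (RingQuot.mkAlgHom k r a) = f a := by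
  let T : (kerCon f).Quotient →ₗ[k] P :=
    { toFun z := Quotient.liftOn' z f fun x y hxy => by simpa using hxy 1 1
      map_add' := by rintro ⟨x⟩ ⟨y⟩; exact map_add f x y
      map_smul' := by rintro c ⟨x⟩; exact map_smul f c x }
  let φ : RingQuot r →ₐ[k] (kerCon f).Quotient := RingQuot.liftAlgHom k
    ⟨(kerCon f).mkₐ k, fun {x y} hxy => (RingCon.eq _).2 (hf x y hxy)⟩
  exact ⟨T ∘ₗ φ.toLinearMap, fun a => congrArg T (RingQuot.liftAlgHom_mkAlgHom_apply ..)⟩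

end TraceCongruence

section Functionals

variable {d n : ℕ} {q : ℂ} {M : Type*} [AddCommGroup M] [Module ℂ M]

/-- The image of a framed braid with modular framings in `Y_{d,n}(q)`. -/
def modularToYH (d : ℕ) (q : ℂ) (n : ℕ) : ModularFramedBraidGroup d n →* YH d q n :=
  (toYH d q n : MonoidAlgebra ℂ (ModularFramedBraidGroup d n) →* YH d q n).comp
    (MonoidAlgebra.of ℂ (ModularFramedBraidGroup d n))

lemma modularToYH_msigma (i : ℕ) (hi : i + 1 < n) :
    modularToYH d q n (msigma d i hi) = g d q i hi := rfl

lemma modularToYH_mframing (j : Fin n) : modularToYH d q n (mframing d j) = t d q j := rfl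

lemma incl_modularToYH (w : ModularFramedBraidGroup d n) :
    incl d q n (modularToYH d q n w) = modularToYH d q (n + 1) (addStrand d n w) := by
  have h : incl d q n (modularToYH d q n w) = (toYH d q (n + 1)).comp (groupAlgebraIncl d n)
      (MonoidAlgebra.of ℂ _ w) := RingQuot.liftAlgHom_mkAlgHom_apply ..
  rw [h, AlgHom.comp_apply, groupAlgebraIncl_of]
  rfl

lemma linearMap_ext_modularToYH {f f' : YH d q n →ₗ[ℂ] M}
    (h : ∀ w, f (modularToYH d q n w) = f' (modularToYH d q n w)) : f = f' := by
  refine LinearMap.ext fun a => ?_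
  obtain ⟨a, rfl⟩ := RingQuot.mkAlgHom_surjective ℂ _ a
  exact LinearMap.congr_fun ((MonoidAlgebra.basis (ModularFramedBraidGroup d n) ℂ).ext
    (f₁ := f ∘ₗ (toYH d q n).toLinearMap) (f₂ := f' ∘ₗ (toYH d q n).toLinearMap) h) a

lemma modularToYH_msigma_sq (i : ℕ) (hi : i + 1 < n) :
    modularToYH d q n (msigma d i hi ^ 2) = 1 + ((q - q⁻¹) / d) • ∑ s ∈ Finset.Icc 1 d,
      modularToYH d q n (mframing d ⟨i, Nat.lt_of_succ_lt hi⟩ ^ s *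
        (mframing d ⟨i + 1, hi⟩ ^ s)⁻¹ * msigma d i hi) := by
  have h := RingQuot.mkAlgHom_rel ℂ (QuadRel.quad (d := d) (q := q) i hi)
  rw [← map_pow] at h
  refine h.trans ?_
  rw [map_add, map_one, idem, smul_mul_assoc, Finset.sum_mul, smul_smul, map_smul, map_sum,
    mul_one_div]
  simp only [← map_mul]
  rfl

lemma isQuadratic_comp_modularToYH (T : YH d q n →ₗ[ℂ] M) :
    IsQuadratic ((q - q⁻¹) / d : ℂ) fun w => T (modularToYH d q n w) := fun i hi v w => by
  simp only [map_mul (modularToYH d q n) _ w, map_mul (modularToYH d q n) v,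
    modularToYH_msigma_sq, mul_add, add_mul, mul_one, mul_smul_comm, smul_mul_assoc,
    Finset.mul_sum, Finset.sum_mul, map_add, map_smul, map_sum]

theorem IsQuadratic.exists_linearMap {f : ModularFramedBraidGroup d n → M}
    (hf : IsQuadratic ((q - q⁻¹) / d : ℂ) f) :
    ∃ T : YH d q n →ₗ[ℂ] M, ∀ w, T (modularToYH d q n w) = f w := by
  let F := (MonoidAlgebra.basis (ModularFramedBraidGroup d n) ℂ).constr ℂ f
  have hF (w) : F (MonoidAlgebra.of ℂ _ w) = f w := Module.Basis.constr_basis _ ℂ f w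
  suffices h : ∀ x y, QuadRel d q n x y → ∀ a b, F (a * x * b) = F (a * y * b) by
    obtain ⟨T, hT⟩ := exists_linearMap_ringQuot F h
    exact ⟨T, fun w => (hT _).trans (hF w)⟩
  rintro _ _ ⟨i, hi⟩ a b
  induction a using MonoidAlgebra.induction_on with
  | add a a' ha ha' => simp only [add_mul, map_add] at ha ha' ⊢; rw [ha, ha']
  | smul c a ha => simp only [smul_mul_assoc, map_smul] at ha ⊢; rw [ha]
  | of v =>
    induction b using MonoidAlgebra.induction_on with
    | add b b' hb hb' => simp only [mul_add _ b, map_add]; rw [hb, hb']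
    | smul c b hb => simp only [mul_smul_comm c _ b, map_smul]; rw [hb]
    | of w =>
      rw [← map_pow, ← map_mul, ← map_mul, hF, hf i hi v w]
      simp only [idem, mul_add, add_mul, mul_one, smul_mul_assoc, mul_smul_comm, Finset.sum_mul,
        Finset.mul_sum, smul_smul, mul_one_div, ← map_mul, map_add, map_smul, map_sum, hF]

end Functionals

section JuyumayaTrace

variable {d : ℕ} [NeZero d] {q : ℂ}

variable (d) in
/-- The parameter `x_s`, with indices modulo `d` and `x_0 = 1`. -/
def xMod (s : ZMod d) : TracePoly d :=
  if h : s.val = 0 then 1 else xVar d ⟨s.val - 1, by have := ZMod.val_lt s; omega⟩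

lemma xMod_zero : xMod d 0 = 1 := dif_pos ZMod.val_zero

lemma xMod_natCast_add_one (k : Fin (d - 1)) : xMod d ((k + 1 : ℕ) : ZMod d) = xVar d k := by
  have hval : (((k : ℕ) + 1 : ℕ) : ZMod d).val = k + 1 := ZMod.val_cast_of_lt (by omega)
  rw [xMod, dif_neg (hval.trans_ne k.1.succ_ne_zero)]
  simp only [hval, Nat.add_sub_cancel]

lemma mframing_zpow_eq_pow_val {n : ℕ} (j : Fin n) (s : ℤ) :
    mframing d j ^ s = mframing d j ^ (s : ZMod d).val := by
  rw [← zpow_natCast, ZMod.val_intCast, ← zpow_eq_zpow_emod' s (mframing_pow_eq_one j)]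

theorem IsJuyumayaTrace.isMarkovTrace {T : ∀ n, YH d q n →ₗ[ℂ] TracePoly d}
    (hT : IsJuyumayaTrace d q T) :
    IsMarkovTrace d (algebraMap ℂ (TracePoly d) ((q - q⁻¹) / d)) (zVar d) (xMod d)
      fun n w => T n (modularToYH d q n w) where
  isQuadratic n i hi v w := by
    simpa only [algebraMap_smul] using isQuadratic_comp_modularToYH (T n) i hi v w
  map_mul_comm n v w := by
    rw [map_mul (modularToYH d q n) v, hT.map_mul_comm, ← map_mul]
  map_one_zero := by rw [(modularToYH d q 0).map_one, hT.map_one]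
  markov n w := by rw [map_mul, ← incl_modularToYH, modularToYH_msigma, hT.markov]
  framing n w s := by
    rw [mframing_zpow_eq_pow_val, map_mul, map_pow, ← incl_modularToYH, modularToYH_mframing]
    obtain hs | hs := eq_or_ne (s : ZMod d) 0
    · rw [hs, ZMod.val_zero, pow_zero, mul_one, hT.map_incl, xMod_zero, one_mul]
    · obtain ⟨k, hk⟩ := Nat.exists_eq_add_one_of_ne_zero ((ZMod.val_ne_zero _).2 hs)
      have hkd : k < d - 1 := by have := ZMod.val_lt (s : ZMod d); omega
      rw [hk, hT.framing n _ ⟨k, hkd⟩, ← xMod_natCast_add_one, ← hk, ZMod.natCast_zmod_val]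

theorem IsMarkovTrace.exists_isJuyumayaTrace {τ : ∀ n, ModularFramedBraidGroup d n → TracePoly d}
    (hτ : IsMarkovTrace d (algebraMap ℂ (TracePoly d) ((q - q⁻¹) / d)) (zVar d) (xMod d) τ) :
    ∃ T, IsJuyumayaTrace d q T := by
  have hquad (n) : IsQuadratic ((q - q⁻¹) / d : ℂ) (τ n) := fun i hi v w => by
    simpa only [algebraMap_smul] using hτ.isQuadratic n i hi v w
  choose T hT using fun n => (hquad n).exists_linearMap
  have map_incl (n) : T (n + 1) ∘ₗ (incl d q n).toLinearMap = T n :=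
    linearMap_ext_modularToYH fun w => by
      simp only [LinearMap.comp_apply, AlgHom.toLinearMap_apply, incl_modularToYH, hT]
      exact hτ.map_addStrand xMod_zero w
  have map_mul_comm (n) : (LinearMap.mul ℂ _).compr₂ (T n) =
      ((LinearMap.mul ℂ _).compr₂ (T n)).flip :=
    linearMap_ext_modularToYH fun v => linearMap_ext_modularToYH fun w => by
      simp only [LinearMap.compr₂_apply, LinearMap.flip_apply, LinearMap.mul_apply', ← map_mul, hT]
      exact hτ.map_mul_comm n v w
  have markov (n) : T (n + 2) ∘ₗ LinearMap.mulRight ℂ (g d q n (Nat.lt_succ_self (n + 1))) ∘ₗ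
      (incl d q (n + 1)).toLinearMap = zVar d • T (n + 1) :=
    linearMap_ext_modularToYH fun w => by
      simp only [LinearMap.comp_apply, AlgHom.toLinearMap_apply, incl_modularToYH,
        LinearMap.mulRight_apply, LinearMap.smul_apply, ← modularToYH_msigma, ← map_mul, hT]
      exact hτ.markov n w
  have framing (n) (k : Fin (d - 1)) : T (n + 1) ∘ₗ
      LinearMap.mulRight ℂ (t d q (Fin.last n) ^ ((k : ℕ) + 1)) ∘ₗ (incl d q n).toLinearMap =
        xVar d k • T n :=
    linearMap_ext_modularToYH fun w => by
      simp only [LinearMap.comp_apply, AlgHom.toLinearMap_apply, incl_modularToYH,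
        LinearMap.mulRight_apply, LinearMap.smul_apply, ← modularToYH_mframing, ← map_mul,
        ← map_pow, hT, ← xMod_natCast_add_one]
      exact_mod_cast hτ.framing n w (k + 1 : ℕ)
  exact ⟨T, fun n => LinearMap.congr_fun (map_incl n),
    fun n => LinearMap.congr_fun₂ (map_mul_comm n),
    fun n => by rw [← (modularToYH d q n).map_one, hT, hτ.map_one xMod_zero],
    fun n => LinearMap.congr_fun (markov n),
    fun n a k => LinearMap.congr_fun (framing n k) a⟩

theorem isJuyumayaTrace_tr : IsJuyumayaTrace d q (tr d q) := by
  obtain ⟨τ, hτ⟩ := exists_isMarkovTrace (algebraMap ℂ (TracePoly d) ((q - q⁻¹) / d)) (zVar d)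
    (xMod d)
  have h := hτ.exists_isJuyumayaTrace
  rw [tr, dif_pos h]
  exact h.choose_spec

theorem tr_braidToYH_list_prod {n m : ℕ} {c : Fin (m + 1) → ℕ} (hc : Monotone c)
    (hcn : c (Fin.last m) ≤ n) {α : Fin m → FramedBraidGroup n}
    (hα : ∀ j, α j ∈ strandBlock n (c j.castSucc) (c j.succ)) :
    tr d q n (braidToYH d q n (List.ofFn α).prod) = ∏ j, tr d q n (braidToYH d q n (α j)) := by
  have h := (isJuyumayaTrace_tr (q := q)).isMarkovTrace.map_list_prod_of_mem_strandGroup xMod_zero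
    hc hcn fun j => reduceFraming_mem_strandGroup (d := d) (hα j)
  have hprod : (List.ofFn fun j => reduceFraming d n (α j)).prod =
      reduceFraming d n (List.ofFn α).prod := by
    rw [map_list_prod, List.map_ofFn]
    rfl
  rwa [hprod] at h

end JuyumayaTrace

end YokonumaHecke

end

theorem mainTheorem10_general (d : ℕ) [NeZero d] (q : ℂ) (hq : q ≠ 0) (n m : ℕ)
    (c : Fin (m + 1) → ℕ) (hc : Monotone c) (hcn : c (Fin.last m) ≤ n)
    (α : Fin m → YokonumaHecke.FramedBraidGroup n)
    (hα : ∀ j : Fin m, α j ∈ YokonumaHecke.strandBlock n (c j.castSucc) (c j.succ)) :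
    (YokonumaHecke.tr d q n (YokonumaHecke.braidToYH d q n (List.ofFn α).prod) =
      ∏ j : Fin m, YokonumaHecke.tr d q n (YokonumaHecke.braidToYH d q n (α j))) ∧
    ∀ x : ZMod d → ℂ,
      YokonumaHecke.specializedTr d q x n (YokonumaHecke.braidToYH d q n (List.ofFn α).prod) =
        ∏ j : Fin m, YokonumaHecke.specializedTr d q x n (YokonumaHecke.braidToYH d q n (α j)) := by
  have h := YokonumaHecke.tr_braidToYH_list_prod (d := d) (q := q) hc hcn hα
  refine ⟨h, fun x => ?_⟩
  simp only [YokonumaHecke.specializedTr, LinearMap.comp_apply, AlgHom.toLinearMap_apply]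
  rw [h, map_prod]

theorem mainTheorem10 (d : ℕ) [NeZero d] (q : ℂ) (hq : q ≠ 0) (n m : ℕ) (hm : 1 ≤ m)
    (c : Fin (m + 1) → ℕ) (hc0 : c 0 = 0) (hc : StrictMono c) (hcn : c (Fin.last m) ≤ n)
    (α : Fin m → YokonumaHecke.FramedBraidGroup n)
    (hα : ∀ j : Fin m, α j ∈ YokonumaHecke.strandBlock n (c j.castSucc) (c j.succ)) :
    (YokonumaHecke.tr d q n (YokonumaHecke.braidToYH d q n (List.ofFn α).prod) =
      ∏ j : Fin m, YokonumaHecke.tr d q n (YokonumaHecke.braidToYH d q n (α j))) ∧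
    (∀ x : ZMod d → ℂ, YokonumaHecke.IsESolution d x →
      YokonumaHecke.specializedTr d q x n
          (YokonumaHecke.braidToYH d q n (List.ofFn α).prod) =
        ∏ j : Fin m, YokonumaHecke.specializedTr d q x n
          (YokonumaHecke.braidToYH d q n (α j))) ∧
    (∀ D : Finset (ZMod d), D.Nonempty →
      YokonumaHecke.trD d q D n (YokonumaHecke.braidToYH d q n (List.ofFn α).prod) =
        ∏ j : Fin m, YokonumaHecke.trD d q D n (YokonumaHecke.braidToYH d q n (α j))) :=
  have ⟨h, hx⟩ := mainTheorem10_general d q hq n m c hc.monotone hcn α hα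
  ⟨h, fun x _ => hx x, fun D _ => hx (YokonumaHecke.eSolution d D)⟩
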